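/- Let $R$ be a commutative noetherian ring, let $S$ be a commutative ring, and let $C$ be a finitely generated $R$-module. Let $f\colon R\to S$ and $g\colon S\to R$ be ring homomorphisms with $g\circ f=\mathrm{id}_R$. View $S$ as an $R$-module via $f$, and assume that $\operatorname{Hom}_R(S,C)\cong S$ as $S$-modules and that $\operatorname{Ext}^i_R(S,C)=0$ for all $i\ge 1$. View every $R$-module as an $S$-module via $g$. Then the following are equivalent: (a) $C$ is semidualizing over $R$, that is, $C$ is finitely generated, $R\cong\operatorname{Hom}_R(C,C)$ as $R$-modules, and $\operatorname{Ext}^i_R(C,C)=0$ for all $i\ge 1$; (b) $R$ is Gorenstein projective over $S$ and $\operatorname{Ann}_R(C)=0$; (c) $C$ is Gorenstein projective over $S$ and $\operatorname{Ann}_R(C)=0$. Here an $S$-module $M$ is Gorenstein projective over $S$ if there is an exact complex $X=\cdots\to X_1\xrightarrow{\partial_1}X_0\xrightarrow{\partial_0}X_{-1}\to\cdots$ of projective $S$-modules such that $\operatorname{Hom}_S(X,Q)$ is exact for every projective $S$-module $Q$ and $M\cong\operatorname{Coker}\partial_1$. -/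

import Mathlib

open CategoryTheory

universe u

/-- A finitely generated module `C` over a commutative ring `R` is semidualizing if
`R ≅ Hom_R(C, C)` as `R`-modules and `Ext^i_R(C, C) = 0` for all `i ≥ 1`. -/
structure IsSemidualizing (R : Type u) [CommRing R] (C : Type u) [AddCommGroup C] [Module R C] :
    Prop where
  finite : Module.Finite R C
  hom_iso : Nonempty (R ≃ₗ[R] (C →ₗ[R] C))
  ext_vanishing : ∀ i : ℕ, 1 ≤ i →
    Subsingleton (Abelian.Ext.{u} (ModuleCat.of R C) (ModuleCat.of R C) i)

/-- A complete projective resolution over `S`: an exact complex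
`⋯ ⟶ X₁ ⟶ X₀ ⟶ X₋₁ ⟶ ⋯` of projective `S`-modules such that `Hom_S(X, Q)` is exact for every
projective `S`-module `Q`. Exactness of `Hom_S(X, Q)` at `Hom_S(Xₙ, Q)` says that each
`φ : Xₙ ⟶ Q` whose composite with `∂ₙ₊₁` is zero is of the form `ψ ∘ ∂ₙ`. -/
structure IsCompleteProjectiveResolution {S : Type u} [CommRing S]
    (X : ChainComplex (ModuleCat.{u} S) ℤ) : Prop where
  projective : ∀ n : ℤ, Projective (X.X n)
  exact : ∀ n : ℤ, X.ExactAt n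
  hom_exact : ∀ Q : ModuleCat.{u} S, Projective Q → ∀ (n : ℤ) (φ : X.X n ⟶ Q),
    X.d (n + 1) n ≫ φ = 0 → ∃ ψ : X.X (n - 1) ⟶ Q, φ = X.d n (n - 1) ≫ ψ

/-- `M` is Gorenstein projective over `S` if it is isomorphic to the cokernel of
`∂₁ : X₁ ⟶ X₀` for some complete projective resolution `X` over `S`. -/
def IsGorensteinProjective (S : Type u) [CommRing S] (M : ModuleCat.{u} S) : Prop :=
  ∃ X : ChainComplex (ModuleCat.{u} S) ℤ,
    IsCompleteProjectiveResolution X ∧ Nonempty (Limits.cokernel (X.d 1 0) ≅ M)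

/-- The retract diagram `R --f--> S --g--> R` with `g ∘ f = id_R`, such that
`Hom_R(S, C) ≅ S` as `S`-modules and `Ext^i_R(S, C) = 0` for all `i ≥ 1`. Here `S` is an
`R`-module through `f`, and `S` acts on `Hom_R(S, C)` by `(s • φ) t = φ (t * s)`. -/
structure IsDualizingRetract {R S : Type u} [CommRing R] [CommRing S] (f : R →+* S) (g : S →+* R)
    (C : Type u) [AddCommGroup C] [Module R C] : Prop where
  retract : g.comp f = RingHom.id R
  hom_iso : Nonempty
    ((ModuleCat.coextendScalars f).obj (ModuleCat.of R C) ≃ₗ[S] S)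
  ext_vanishing : ∀ i : ℕ, 1 ≤ i →
    Subsingleton (Abelian.Ext.{u}
      ((ModuleCat.restrictScalars f).obj (ModuleCat.of S S)) (ModuleCat.of R C) i)

/-! The isomorphism `Hom_R(S, C) ≅ S` yields a form `ℓ : S → C` for which composition gives
`Hom_S(M, S) ≅ Hom_R(M, C)` for every `S`-module `M` (`IsDualizingForm.homEquiv`). Together with the
vanishing of `Ext_R(S, C)`, this lets `Ext_R(-, C)` play the role of `Ext_S(-, S)`. In particular
`Hom_S(R, S) ≅ C`, and biduality of `R` over `S` becomes the homothety `R → Hom_R(C, C)`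
(`bijective_eval_iff`). Thus `C` is semidualizing exactly when `R` is totally reflexive over `S`;
then its `S`-dual `C` is totally reflexive as well.

Conversely, let `C` be totally reflexive over `S` with zero annihilator. Then every `C`-valued form
on `Hom_R(C, C)` is an evaluation and `Ext_R(Hom_R(C, C), C)` vanishes in positive degrees. The
cokernel of the injective homothety map therefore has no `Ext` into `C` in any degree, which forces
it to be zero (`annihilator_smul_top_of_forall_subsingleton` and Nakayama).

What remains is that finitely generated Gorenstein projective modules are the totally reflexive
ones. A complete resolution may have infinitely generated syzygies; finite approximations, compared
with it by the dual of Schanuel's lemma, replace them (`isStablyEquiv_cokernel`).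

All this needs `S` noetherian, which follows from `S` being finite over `R` (`finite_of_selfDual`).
The Koszul complex over `S` on generators of a maximal ideal `m` is self-dual under `Hom_R(-, C)`,
with homology a sum of copies of `k = R/m`. If the homology were infinite, dualizing would produce
spaces `k^ι`, too large by Erdős–Kaplansky for the homology that must account for them
(`finite_homology`). Hence `S/mS` is finite for the relevant `m`, and finitely many elements of `S`
detect all maps `S → C`, embedding `S` in a finite power of `C`. -/

/-! ### Functoriality and long exact sequences of Ext -/

section ExtModule

variable {R : Type u} [CommRing R]

/-- `Ext^i_R(M, C)` for unbundled modules. -/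
abbrev ExtMod (R : Type u) [CommRing R] (M C : Type u) [AddCommGroup M] [Module R M]
    [AddCommGroup C] [Module R C] (i : ℕ) : Type u :=
  Abelian.Ext.{u} (ModuleCat.of R M) (ModuleCat.of R C) i

namespace ExtMod

variable {A B D M C C' : Type u} [AddCommGroup A] [Module R A] [AddCommGroup B] [Module R B]
  [AddCommGroup D] [Module R D] [AddCommGroup M] [Module R M]
  [AddCommGroup C] [Module R C] [AddCommGroup C'] [Module R C']

/-- Contravariant functoriality of `Ext`. -/
noncomputable def map (C : Type u) [AddCommGroup C] [Module R C] (f : A →ₗ[R] B) (i : ℕ) :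
    ExtMod R B C i →ₗ[R] ExtMod R A C i :=
  (Abelian.Ext.mk₀ (ModuleCat.ofHom f)).precompOfLinear R (ModuleCat.of R C) (zero_add i)

/-- Covariant functoriality of `Ext`. -/
noncomputable def comap (M : Type u) [AddCommGroup M] [Module R M] (f : C →ₗ[R] C') (i : ℕ) :
    ExtMod R M C i →ₗ[R] ExtMod R M C' i :=
  (Abelian.Ext.mk₀ (ModuleCat.ofHom f)).postcompOfLinear R (ModuleCat.of R M) (add_zero i)

lemma map_apply (f : A →ₗ[R] B) (i : ℕ) (x : ExtMod R B C i) :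
    map C f i x = (Abelian.Ext.mk₀ (ModuleCat.ofHom f)).comp x (zero_add i) := rfl

lemma comap_apply (f : C →ₗ[R] C') (i : ℕ) (x : ExtMod R M C i) :
    comap M f i x = x.comp (Abelian.Ext.mk₀ (ModuleCat.ofHom f)) (add_zero i) := rfl

lemma map_comp (f : A →ₗ[R] B) (g : B →ₗ[R] D) (i : ℕ) (x : ExtMod R D C i) :
    map C (g ∘ₗ f) i x = map C f i (map C g i x) := by
  simp only [map_apply, ModuleCat.ofHom_comp, Abelian.Ext.mk₀_comp_mk₀_assoc]

lemma map_id (i : ℕ) (x : ExtMod R A C i) : map C (LinearMap.id : A →ₗ[R] A) i x = x := by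
  simp [map_apply]

lemma map_comap (f : A →ₗ[R] B) (g : C →ₗ[R] C') (i : ℕ) (x : ExtMod R B C i) :
    map C' f i (comap B g i x) = comap A g i (map C f i x) := by
  simp only [map_apply, comap_apply]
  exact (Abelian.Ext.comp_assoc_of_third_deg_zero _ _ _ _).symm

/-- `Ext` is invariant under isomorphisms in the first variable. -/
noncomputable def congr (C : Type u) [AddCommGroup C] [Module R C] (e : A ≃ₗ[R] B) (i : ℕ) :
    ExtMod R B C i ≃ₗ[R] ExtMod R A C i :=
  LinearEquiv.ofLinearMap (map C e.toLinearMap i) (map C e.symm.toLinearMap i)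
    (by ext x; simp [← map_comp, map_id])
    (by ext x; simp [← map_comp, map_id])

/-- `Ext⁰` is `Hom`. -/
noncomputable def zeroEquiv (R M C : Type u) [CommRing R] [AddCommGroup M] [Module R M]
    [AddCommGroup C] [Module R C] : ExtMod R M C 0 ≃ₗ[R] (M →ₗ[R] C) :=
  Abelian.Ext.linearEquiv₀.trans ModuleCat.homLinearEquiv

lemma zeroEquiv_symm_apply (φ : M →ₗ[R] C) :
    (zeroEquiv R M C).symm φ = Abelian.Ext.mk₀ (ModuleCat.ofHom φ) := rfl

lemma map_zeroEquiv_symm (f : A →ₗ[R] B) (φ : B →ₗ[R] C) :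
    map C f 0 ((zeroEquiv R B C).symm φ) = (zeroEquiv R A C).symm (φ ∘ₗ f) := by
  simp [zeroEquiv_symm_apply, map_apply]

lemma zeroEquiv_map (f : A →ₗ[R] B) (x : ExtMod R B C 0) :
    zeroEquiv R A C (map C f 0 x) = zeroEquiv R B C x ∘ₗ f := by
  obtain ⟨φ, rfl⟩ := (zeroEquiv R B C).symm.surjective x
  simp [map_zeroEquiv_symm]

section Sequence

variable {f : A →ₗ[R] B} {g : B →ₗ[R] D}

lemma shortExact (hf : Function.Injective f) (hg : Function.Surjective g)
    (h : Function.Exact f g) :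
    (ShortComplex.mk (ModuleCat.ofHom f) (ModuleCat.ofHom g)
      (by rw [← ModuleCat.ofHom_comp, h.linearMap_comp_eq_zero]; rfl)).ShortExact where
  exact := (ShortComplex.ShortExact.moduleCat_exact_iff_function_exact _).mpr h
  mono_f := (ModuleCat.mono_iff_injective _).mpr hf
  epi_g := (ModuleCat.epi_iff_surjective _).mpr hg

lemma exact_map (hf : Function.Injective f) (hg : Function.Surjective g)
    (h : Function.Exact f g) (i : ℕ) : Function.Exact (map C g i) (map C f i) := by
  intro x
  constructor
  · exact fun hx => Abelian.Ext.contravariant_sequence_exact₂ (shortExact hf hg h) _ x hx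
  · rintro ⟨y, rfl⟩
    rw [← map_comp, h.linearMap_comp_eq_zero]
    simp only [map_apply]
    simp [ModuleCat.ofHom_zero]

/-- The contravariant connecting homomorphism. -/
lemma exists_connecting (hf : Function.Injective f) (hg : Function.Surjective g)
    (h : Function.Exact f g) (i : ℕ) :
    ∃ δ : ExtMod R A C i →ₗ[R] ExtMod R D C (i + 1),
      Function.Exact (map C f i) δ ∧ Function.Exact δ (map C g (i + 1)) := by
  have hS := shortExact hf hg h
  refine ⟨hS.extClass.precompOfLinear R (ModuleCat.of R C) (add_comm 1 i), fun x => ?_, fun x => ?_⟩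
  · constructor
    · exact fun hx => Abelian.Ext.contravariant_sequence_exact₁ hS _ x (add_comm 1 i) hx
    · rintro ⟨y, rfl⟩
      exact @ShortComplex.ShortExact.extClass_comp_assoc _ _ _ _ _ hS _ _ y _ (add_comm 1 i)
  · constructor
    · exact fun hx => Abelian.Ext.contravariant_sequence_exact₃ hS _ x hx (add_comm 1 i)
    · rintro ⟨y, rfl⟩
      exact hS.comp_extClass_assoc y (add_comm 1 i)

lemma subsingleton_mid (hf : Function.Injective f) (hg : Function.Surjective g)
    (h : Function.Exact f g) {i : ℕ} (hA : Subsingleton (ExtMod R A C i))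
    (hD : Subsingleton (ExtMod R D C i)) : Subsingleton (ExtMod R B C i) := by
  refine subsingleton_of_forall_eq 0 fun x => ?_
  obtain ⟨y, rfl⟩ := (exact_map hf hg h i x).mp (Subsingleton.elim _ _)
  rw [Subsingleton.elim y 0, map_zero]

lemma subsingleton_left (hf : Function.Injective f) (hg : Function.Surjective g)
    (h : Function.Exact f g) {i : ℕ} (hB : Subsingleton (ExtMod R B C i))
    (hD : Subsingleton (ExtMod R D C (i + 1))) : Subsingleton (ExtMod R A C i) := by
  obtain ⟨δ, h1, -⟩ := exists_connecting (C := C) hf hg h i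
  refine subsingleton_of_forall_eq 0 fun x => ?_
  obtain ⟨y, rfl⟩ := (h1 x).mp (Subsingleton.elim _ _)
  rw [Subsingleton.elim y 0, map_zero]

lemma subsingleton_right (hf : Function.Injective f) (hg : Function.Surjective g)
    (h : Function.Exact f g) {i : ℕ} (hA : Subsingleton (ExtMod R A C i))
    (hB : Subsingleton (ExtMod R B C (i + 1))) : Subsingleton (ExtMod R D C (i + 1)) := by
  obtain ⟨δ, -, h2⟩ := exists_connecting (C := C) hf hg h i
  refine subsingleton_of_forall_eq 0 fun x => ?_
  obtain ⟨y, rfl⟩ := (h2 x).mp (Subsingleton.elim _ _)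
  rw [Subsingleton.elim y 0, map_zero]

/-- If `Ext¹(D, C) = 0` then linear maps to `C` extend along `A → B`. -/
lemma exists_extension (hf : Function.Injective f) (hg : Function.Surjective g)
    (h : Function.Exact f g) (hD : Subsingleton (ExtMod R D C 1)) (φ : A →ₗ[R] C) :
    ∃ ψ : B →ₗ[R] C, ψ ∘ₗ f = φ := by
  obtain ⟨δ, h1, -⟩ := exists_connecting (C := C) hf hg h 0
  obtain ⟨y, hy⟩ := (h1 ((zeroEquiv R A C).symm φ)).mp (Subsingleton.elim _ _)
  refine ⟨zeroEquiv R B C y, ?_⟩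
  rw [← zeroEquiv_map, hy, LinearEquiv.apply_symm_apply]

/-- If `Ext¹(B, C) = 0` and linear maps to `C` extend along `A → B`, then `Ext¹(D, C) = 0`. -/
lemma subsingleton_one (hf : Function.Injective f) (hg : Function.Surjective g)
    (h : Function.Exact f g) (hB : Subsingleton (ExtMod R B C 1))
    (hext : ∀ φ : A →ₗ[R] C, ∃ ψ : B →ₗ[R] C, ψ ∘ₗ f = φ) : Subsingleton (ExtMod R D C 1) := by
  obtain ⟨δ, h1, h2⟩ := exists_connecting (C := C) hf hg h 0
  refine subsingleton_of_forall_eq 0 fun x => ?_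
  obtain ⟨y, rfl⟩ := (h2 x).mp (Subsingleton.elim _ _)
  obtain ⟨ψ, hψ⟩ := hext (zeroEquiv R A C y)
  refine (h1 y).mpr ⟨(zeroEquiv R B C).symm ψ, ?_⟩
  rw [map_zeroEquiv_symm, hψ, LinearEquiv.symm_apply_apply]

/-- The covariant connecting homomorphism, natural in the first variable. -/
lemma exists_coconnecting (hf : Function.Injective f) (hg : Function.Surjective g)
    (h : Function.Exact f g) (i : ℕ) :
    ∃ δ : ∀ (M : Type u) [AddCommGroup M] [Module R M], ExtMod R M D i →ₗ[R] ExtMod R M A (i + 1),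
      (∀ (M : Type u) [AddCommGroup M] [Module R M],
        Function.Exact (comap M g i) (δ M) ∧ Function.Exact (δ M) (comap M f (i + 1))) ∧
      ∀ (M N : Type u) [AddCommGroup M] [Module R M] [AddCommGroup N] [Module R N]
        (φ : M →ₗ[R] N) (x : ExtMod R N D i), map A φ (i + 1) (δ N x) = δ M (map D φ i x) := by
  have hS := shortExact hf hg h
  refine ⟨fun M _ _ => hS.extClass.postcompOfLinear R (ModuleCat.of R M) rfl,
    fun M _ _ => ⟨fun x => ?_, fun x => ?_⟩, fun M N _ _ _ _ φ x => ?_⟩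
  · constructor
    · exact fun hx => Abelian.Ext.covariant_sequence_exact₃ _ hS x rfl hx
    · rintro ⟨y, rfl⟩
      refine (Abelian.Ext.comp_assoc_of_second_deg_zero _ _ _ rfl).trans ?_
      exact (congrArg (fun t => Abelian.Ext.comp y t rfl) hS.comp_extClass).trans
        (Abelian.Ext.comp_zero _ _ _ _ _)
  · constructor
    · exact fun hx => Abelian.Ext.covariant_sequence_exact₁ _ hS x hx rfl
    · rintro ⟨y, rfl⟩
      refine (Abelian.Ext.comp_assoc_of_third_deg_zero _ _ _ rfl).trans ?_
      exact (congrArg (fun t => Abelian.Ext.comp y t rfl) hS.extClass_comp).trans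
        (Abelian.Ext.comp_zero _ _ _ _ _)
  · exact (Abelian.Ext.comp_assoc _ _ _ (zero_add i) rfl (by lia)).symm

end Sequence

end ExtMod

end ExtModule

namespace ExtMod

section

variable {R : Type u} [CommRing R]

lemma subsingleton_of_retract {A B C : Type u} [AddCommGroup A] [Module R A] [AddCommGroup B]
    [Module R B] [AddCommGroup C] [Module R C] (f : A →ₗ[R] B) (r : B →ₗ[R] A)
    (h : r ∘ₗ f = LinearMap.id) {i : ℕ} (hB : Subsingleton (ExtMod R B C i)) :
    Subsingleton (ExtMod R A C i) := by
  refine subsingleton_of_forall_eq 0 fun x => ?_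
  rw [← map_id i x, ← h, map_comp, Subsingleton.elim (map C r i x) 0, map_zero]

lemma subsingleton_congr {A B C : Type u} [AddCommGroup A] [Module R A] [AddCommGroup B]
    [Module R B] [AddCommGroup C] [Module R C] (e : A ≃ₗ[R] B) {i : ℕ}
    (hB : Subsingleton (ExtMod R B C i)) : Subsingleton (ExtMod R A C i) :=
  (congr C e i).symm.toEquiv.subsingleton

lemma subsingleton_of_projective (A C : Type u) [AddCommGroup A] [Module R A] [AddCommGroup C]
    [Module R C] [Module.Projective R A] (i : ℕ) : Subsingleton (ExtMod R A C (i + 1)) := by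
  have : Projective (ModuleCat.of R A) := (IsProjective.iff_projective A).mp inferInstance
  exact subsingleton_of_forall_eq 0 fun x => Abelian.Ext.eq_zero_of_projective x

/-- Allows dimension shifting in the second variable. -/
lemma exists_injective_embedding (C : Type u) [AddCommGroup C] [Module R C] :
    ∃ (I : Type u) (_ : AddCommGroup I) (_ : Module R I) (f : C →ₗ[R] I),
      Function.Injective f ∧ ∀ (M : Type u) [AddCommGroup M] [Module R M] (i : ℕ),
        Subsingleton (ExtMod R M I (i + 1)) := by
  refine ⟨(Injective.under (ModuleCat.of R C) : ModuleCat.{u} R), inferInstance, inferInstance,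
    (Injective.ι (ModuleCat.of R C)).hom, (ModuleCat.mono_iff_injective _).mp inferInstance,
    fun M _ _ i => subsingleton_of_forall_eq 0 fun x => ?_⟩
  exact Abelian.Ext.eq_zero_of_injective (I := Injective.under (ModuleCat.of R C)) x

/-- `Ext^i(-, C)` turns direct sums into products. -/
lemma bijective_finsupp (A : Type u) [AddCommGroup A] [Module R A] (ι : Type u) (i : ℕ)
    (C : Type u) [AddCommGroup C] [Module R C] :
    Function.Bijective (LinearMap.pi fun a => map C (Finsupp.lsingle a : A →ₗ[R] ι →₀ A) i) := by
  induction i generalizing C with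
  | zero =>
    constructor
    · intro x y h
      obtain ⟨φ, rfl⟩ := (zeroEquiv R _ C).symm.surjective x
      obtain ⟨ψ, rfl⟩ := (zeroEquiv R _ C).symm.surjective y
      congr 1
      refine Finsupp.lhom_ext' fun a => ?_
      have := congrFun h a
      simpa [map_zeroEquiv_symm] using this
    · intro y
      refine ⟨(zeroEquiv R _ C).symm (Finsupp.lsum ℕ fun a => zeroEquiv R A C (y a)), ?_⟩
      funext a
      rw [LinearMap.pi_apply, map_zeroEquiv_symm, LinearEquiv.symm_apply_eq]
      ext b
      simp
  -- `Ext^{i+1}(-, C)` is naturally the cokernel of `Ext^i(-, I) → Ext^i(-, I/C)`. For `i = 0` the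
  -- source need not vanish, so the induction hypothesis is needed for both `I` and `I/C`.
  | succ i ih =>
    obtain ⟨I, _, _, f, hf, hI⟩ := exists_injective_embedding (R := R) C
    obtain ⟨δ, hδ, hnat⟩ := exists_coconnecting hf (LinearMap.range f).mkQ_surjective
      (LinearMap.exact_map_mkQ_range f) i
    have hsurj : ∀ (M : Type u) [AddCommGroup M] [Module R M], Function.Surjective (δ M) :=
      fun M _ _ x => ((hδ M).2 x).mp ((hI M i).elim _ _)
    constructor
    · refine (injective_iff_map_eq_zero _).mpr fun x hx => ?_
      obtain ⟨y, rfl⟩ := hsurj _ x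
      have hz : ∀ a, ∃ z, comap A (LinearMap.range f).mkQ i z =
          map _ (Finsupp.lsingle a : A →ₗ[R] ι →₀ A) i y := fun a =>
        ((hδ A).1 _).mp ((hnat _ _ _ _).symm.trans (congrFun hx a))
      choose z hz using hz
      obtain ⟨w, hw⟩ := (ih I).2 z
      refine ((hδ _).1 y).mpr ⟨w, (ih _).1 ?_⟩
      funext a
      simp only [LinearMap.pi_apply]
      rw [map_comap, ← hz, ← hw]
      rfl
    · intro y
      choose z hz using fun a => hsurj A (y a)
      obtain ⟨w, hw⟩ := (ih _).2 z
      refine ⟨δ _ w, funext fun a => ?_⟩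
      simp only [LinearMap.pi_apply, hnat]
      rw [← hz, ← hw]
      rfl

/-- If `J` annihilates `M` then it annihilates `Ext^i(M, C)`. -/
lemma smul_eq_zero {M C : Type u} [AddCommGroup M] [Module R M] [AddCommGroup C] [Module R C]
    {r : R} (hr : ∀ m : M, r • m = 0) (i : ℕ) (x : ExtMod R M C i) : r • x = 0 := by
  have h : map C (r • LinearMap.id : M →ₗ[R] M) i x = r • x := by
    rw [map_apply, show ModuleCat.ofHom (r • LinearMap.id : M →ₗ[R] M) =
      r • ModuleCat.ofHom LinearMap.id from rfl, Abelian.Ext.mk₀_smul, Abelian.Ext.smul_comp]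
    exact congrArg (r • ·) (map_id i x)
  rw [← h, show (r • LinearMap.id : M →ₗ[R] M) = 0 from LinearMap.ext hr]
  simp [map_apply, ModuleCat.ofHom_zero]

end

/-! ### Nonvanishing of Ext -/

section Nonvanishing

variable {R : Type u} [CommRing R] [IsNoetherianRing R]

/-- If `Ext^i(N, C)` vanishes for all `i`, then `C = Ann(N) C`. -/
lemma annihilator_smul_top_of_forall_subsingleton {N C : Type u} [AddCommGroup N] [Module R N]
    [Module.Finite R N] [AddCommGroup C] [Module R C] [Module.Finite R C]
    (h : ∀ i, Subsingleton (ExtMod R N C i)) :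
    Module.annihilator R N • (⊤ : Submodule R C) = ⊤ := by
  -- Noetherian induction on the kernel of a quotient map `C → M`: vanishing of `Hom(N, M)` gives an
  -- `M`-regular `x` in `Ann(N)`, and all `Ext^i(N, M/xM)` vanish again.
  suffices H : ∀ (K : Submodule R C) (M : Type u) [AddCommGroup M] [Module R M] (p : C →ₗ[R] M),
      Function.Surjective p → LinearMap.ker p = K → (∀ i, Subsingleton (ExtMod R N M i)) →
      Module.annihilator R N • (⊤ : Submodule R M) = ⊤ from
    H ⊥ C LinearMap.id Function.surjective_id LinearMap.ker_id h
  intro K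
  induction K using WellFoundedGT.induction with
  | _ K ih =>
  intro M _ _ p hp hK hM
  have : Module.Finite R M := Module.Finite.of_surjective p hp
  have hhom : Subsingleton (N →ₗ[R] M) := (zeroEquiv R N M).symm.toEquiv.subsingleton_congr.mpr (hM 0)
  obtain ⟨x, hx, hreg⟩ := IsSMulRegular.subsingleton_linearMap_iff.mp hhom
  let f : M →ₗ[R] M := LinearMap.lsmul R M x
  have hf : Function.Injective f := hreg
  let q := (LinearMap.range f).mkQ
  have hq : Function.Surjective q := (LinearMap.range f).mkQ_surjective
  have hle : LinearMap.range f ≤ Module.annihilator R N • (⊤ : Submodule R M) := by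
    rintro _ ⟨m, rfl⟩
    exact Submodule.smul_mem_smul hx trivial
  have hM' : ∀ i, Subsingleton (ExtMod R N (M ⧸ LinearMap.range f) i) := fun i => by
    obtain ⟨δ, hδ, -⟩ := exists_coconnecting hf hq (LinearMap.exact_map_mkQ_range f) i
    refine subsingleton_of_forall_eq 0 fun y => ?_
    obtain ⟨z, rfl⟩ := ((hδ N).1 y).mp ((hM (i + 1)).elim _ _)
    rw [(hM i).elim z 0, map_zero]
  by_cases htop : LinearMap.range f = ⊤
  · exact top_le_iff.mp (htop ▸ hle)
  by_cases hlt : K < LinearMap.ker (q ∘ₗ p)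
  · have := ih _ hlt _ (q ∘ₗ p) (hq.comp hp) rfl hM'
    have h2 := congrArg (Submodule.comap q) this
    rw [Submodule.comap_smul_top_of_surjective _ _ hq, Submodule.comap_top, Submodule.ker_mkQ,
      sup_eq_left.mpr hle] at h2
    exact h2
  · exfalso
    -- If the kernel does not grow, then `xM = 0`; regularity of `x` gives `M = 0`.
    have hKle : K ≤ LinearMap.ker (q ∘ₗ p) := hK ▸ LinearMap.ker_le_ker_comp p q
    have hge : LinearMap.ker (q ∘ₗ p) ≤ K := by
      by_contra hne
      exact hlt (lt_of_le_not_ge hKle hne)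
    have hzero : ∀ m : M, x • m = 0 := fun m => by
      obtain ⟨c, hc⟩ := hp (x • m)
      have : c ∈ LinearMap.ker (q ∘ₗ p) := by
        rw [LinearMap.mem_ker, LinearMap.comp_apply, hc]
        exact (Submodule.Quotient.mk_eq_zero _).mpr ⟨m, rfl⟩
      rw [← hc]
      exact LinearMap.mem_ker.mp (hK ▸ hge this)
    have : Subsingleton M := ⟨fun a b => hreg ((hzero a).trans (hzero b).symm)⟩
    exact htop (Subsingleton.elim _ _)

end Nonvanishing

end ExtMod

/-! ### Cardinal bounds on generators -/

section IsGeneratedBy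

open Cardinal

/-- `M` is generated by at most `κ` elements. -/
def IsGeneratedBy (R : Type u) [CommRing R] (κ : Cardinal.{u}) (M : Type u) [AddCommGroup M]
    [Module R M] : Prop :=
  ∃ s : Set M, #s ≤ κ ∧ Submodule.span R s = ⊤

namespace IsGeneratedBy

variable {R : Type u} [CommRing R] {κ : Cardinal.{u}}
  {M N P : Type u} [AddCommGroup M] [Module R M] [AddCommGroup N] [Module R N]
  [AddCommGroup P] [Module R P]

lemma of_surjective (h : IsGeneratedBy R κ M) (f : M →ₗ[R] N) (hf : Function.Surjective f) :
    IsGeneratedBy R κ N := by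
  obtain ⟨s, hs, hspan⟩ := h
  exact ⟨f '' s, mk_image_le.trans hs, by
    rw [Submodule.span_image, hspan, Submodule.map_top, LinearMap.range_eq_top.mpr hf]⟩

lemma congr (h : IsGeneratedBy R κ M) (e : M ≃ₗ[R] N) : IsGeneratedBy R κ N :=
  h.of_surjective e.toLinearMap e.surjective

/-- Over a noetherian ring, submodules inherit generation by infinitely many elements. -/
lemma submodule [IsNoetherianRing R] (hκ : ℵ₀ ≤ κ) (h : IsGeneratedBy R κ M)
    (K : Submodule R M) : IsGeneratedBy R κ K := by
  classical
  obtain ⟨s, hs, hspan⟩ := h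
  -- `K` is the union of its intersections with the spans of finite subsets of `s`; each is finitely
  -- generated, and there are at most `κ` of them.
  have hfg : ∀ t : Finset s, ∃ g : Finset M,
      Submodule.span R (g : Set M) = Submodule.span R ((fun x : s => (x : M)) '' (t : Set s)) ⊓ K :=
    fun t => by
    have : IsNoetherian R (Submodule.span R ((fun x : s => (x : M)) '' (t : Set s))) :=
      isNoetherian_span_of_finite R (t.finite_toSet.image _)
    have hN := isNoetherian_of_le (inf_le_left :
      Submodule.span R ((fun x : s => (x : M)) '' (t : Set s)) ⊓ K ≤ _)
    exact (isNoetherian_submodule.mp hN _ le_rfl)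
  choose g hg using hfg
  have hgK : ∀ t, ∀ x ∈ g t, x ∈ K := fun t x hx =>
    (hg t ▸ Submodule.subset_span (Finset.mem_coe.mpr hx) : x ∈ _ ⊓ K).2
  have hcard : #(Finset s) ≤ κ := by
    rcases finite_or_infinite s with hfin | hinf
    · exact (mk_lt_aleph0_iff.mpr inferInstance).le.trans hκ
    · rwa [mk_finset_of_infinite]
  refine ⟨⋃ t, Subtype.val ⁻¹' (g t : Set M), ?_, ?_⟩
  · refine (mk_iUnion_le _).trans ((mul_le_mul' hcard (ciSup_le' fun t => ?_)).trans
      (mul_eq_self hκ).le)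
    have : Finite (Subtype.val ⁻¹' (g t : Set M) : Set K) :=
      (Set.Finite.preimage Subtype.val_injective.injOn (g t).finite_toSet)
    exact (mk_lt_aleph0_iff.mpr this).le.trans hκ
  · rw [eq_top_iff]
    rintro ⟨x, hxK⟩ -
    have hx : x ∈ Submodule.span R (Set.range fun x : s => (x : M)) := by
      rw [Subtype.range_coe, hspan]; trivial
    obtain ⟨c, hc⟩ := (Finsupp.mem_span_range_iff_exists_finsupp).mp hx
    have hx' : x ∈ Submodule.span R (g c.support : Set M) := by
      rw [hg]
      refine ⟨?_, hxK⟩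
      rw [← hc]
      exact Submodule.sum_mem _ fun i hi => Submodule.smul_mem _ _
        (Submodule.subset_span ⟨i, hi, rfl⟩)
    have hmap : (Submodule.span R (Subtype.val ⁻¹' (g c.support : Set M) : Set K)).map K.subtype =
        Submodule.span R (g c.support : Set M) := by
      rw [Submodule.map_span]
      congr 1
      ext y
      constructor
      · rintro ⟨z, hz, rfl⟩; exact hz
      · exact fun hy => ⟨⟨y, hgK _ y hy⟩, hy, rfl⟩
    rw [← hmap] at hx'
    obtain ⟨y, hy, hyx⟩ := hx'
    have : y = ⟨x, hxK⟩ := Subtype.ext hyx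
    rw [← this]
    exact Submodule.span_mono (Set.subset_iUnion (fun t => (Subtype.val ⁻¹' (g t : Set M) : Set K)) c.support) hy

lemma of_injective [IsNoetherianRing R] (hκ : ℵ₀ ≤ κ) (h : IsGeneratedBy R κ N) (f : M →ₗ[R] N)
    (hf : Function.Injective f) : IsGeneratedBy R κ M :=
  (h.submodule hκ (LinearMap.range f)).congr (LinearEquiv.ofInjective f hf).symm

lemma of_exact [IsNoetherianRing R] (hκ : ℵ₀ ≤ κ) {f : M →ₗ[R] N} {g : N →ₗ[R] P}
    (h : Function.Exact f g) (hM : IsGeneratedBy R κ M) (hP : IsGeneratedBy R κ P) :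
    IsGeneratedBy R κ N := by
  obtain ⟨s, hs, hsM⟩ := hM
  obtain ⟨t, ht, htP⟩ := (hP.submodule hκ (LinearMap.range g))
  choose σ hσ using LinearMap.surjective_rangeRestrict g
  refine ⟨f '' s ∪ σ '' t, (mk_union_le _ _).trans ((add_le_add (mk_image_le.trans hs)
    (mk_image_le.trans ht)).trans (add_eq_self hκ).le), ?_⟩
  rw [eq_top_iff]
  intro x _
  have hx : g.rangeRestrict x ∈ Submodule.map g.rangeRestrict (Submodule.span R (σ '' t)) := by
    rw [Submodule.map_span, ← Set.image_comp]
    have : g.rangeRestrict ∘ σ = id := funext hσ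
    rw [this, Set.image_id, htP]; trivial
  obtain ⟨y, hy, hyx⟩ := hx
  have : g (x - y) = 0 := by
    rw [map_sub, sub_eq_zero]; exact (congrArg Subtype.val hyx).symm
  obtain ⟨z, hz⟩ := (h _).mp this
  have hz' : f z ∈ Submodule.span R (f '' s) := by
    rw [Submodule.span_image, hsM]; exact ⟨z, trivial, rfl⟩
  rw [Submodule.span_union, ← sub_add_cancel x y, ← hz]
  exact Submodule.add_mem_sup hz' hy

lemma pi (hκ : ℵ₀ ≤ κ) {n : ℕ} (h : IsGeneratedBy R κ M) : IsGeneratedBy R κ (Fin n → M) := by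
  classical
  obtain ⟨s, hs, hspan⟩ := h
  refine ⟨⋃ i : ULift.{u} (Fin n), LinearMap.single R (fun _ => M) i.down '' s, ?_, ?_⟩
  · refine (mk_iUnion_le _).trans ((mul_le_mul' ((mk_lt_aleph0_iff.mpr inferInstance).le.trans hκ)
      (ciSup_le' fun i => mk_image_le.trans hs)).trans (mul_eq_self hκ).le)
  · rw [eq_top_iff, ← LinearMap.iSup_range_single R (fun _ : Fin n => M)]
    refine iSup_le fun i => ?_
    rw [LinearMap.range_eq_map, ← hspan, Submodule.map_span]
    exact Submodule.span_mono (Set.subset_iUnion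
      (fun i : ULift.{u} (Fin n) => LinearMap.single R (fun _ => M) i.down '' s) ⟨i⟩)

end IsGeneratedBy

section ResidueField

variable {R : Type u} [CommRing R] (m : Ideal R) [m.IsMaximal]

/-- A module annihilated by a maximal ideal is a direct sum of copies of the residue field. -/
lemma exists_equiv_finsupp_of_maximal (M : Type u) [AddCommGroup M] [Module R M]
    (h : ∀ r ∈ m, ∀ x : M, r • x = 0) : ∃ ι : Type u, Nonempty (M ≃ₗ[R] (ι →₀ R ⧸ m)) := by
  let _ := Ideal.Quotient.field m
  let _ : Module (R ⧸ m) M := Module.IsTorsionBySet.module (I := m) fun x r => h r r.2 x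
  have : IsScalarTower R (R ⧸ m) M := Module.IsTorsionBySet.isScalarTower _
  let b := Module.Free.chooseBasis (R ⧸ m) M
  exact ⟨_, ⟨b.repr.restrictScalars R⟩⟩

lemma rank_le_of_isGeneratedBy {κ : Cardinal.{u}} {M : Type u} [AddCommGroup M] [Module R M]
    [Module (R ⧸ m) M] [IsScalarTower R (R ⧸ m) M] (h : IsGeneratedBy R κ M) :
    Module.rank (R ⧸ m) M ≤ κ := by
  let _ := Ideal.Quotient.field m
  obtain ⟨s, hs, hspan⟩ := h
  have : Submodule.span (R ⧸ m) s = ⊤ := by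
    rw [eq_top_iff]
    intro x _
    have hx : x ∈ Submodule.span R s := hspan ▸ trivial
    exact Submodule.span_subset_span R (R ⧸ m) s hx
  rw [← rank_top (R ⧸ m) M, ← this]
  exact (rank_span_le s).trans hs

lemma isGeneratedBy_finsupp_iff {κ : Cardinal.{u}} {ι : Type u} :
    IsGeneratedBy R κ (ι →₀ R ⧸ m) ↔ #ι ≤ κ := by
  let _ := Ideal.Quotient.field m
  constructor
  · intro h
    have := rank_le_of_isGeneratedBy m h
    rwa [rank_finsupp_self'] at this
  · intro h
    refine ⟨Set.range fun i : ι => Finsupp.single i 1, mk_range_le.trans h, ?_⟩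
    rw [eq_top_iff]
    intro x _
    induction x using Finsupp.induction_linear with
    | zero => exact zero_mem _
    | add x y hx hy => exact add_mem (hx trivial) (hy trivial)
    | single i a =>
      obtain ⟨r, rfl⟩ := Ideal.Quotient.mk_surjective a
      have : Finsupp.single i (Ideal.Quotient.mk m r) =
          r • (Finsupp.single i 1 : ι →₀ R ⧸ m) := by
        rw [Finsupp.smul_single, Algebra.smul_def, mul_one]; rfl
      rw [this]
      exact Submodule.smul_mem _ _ (Submodule.subset_span ⟨i, rfl⟩)

/-- Erdős–Kaplansky: the dimension of `k^ι` is its cardinality, at least `2^#ι > #ι`. -/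
lemma not_isGeneratedBy_pi (ι : Type u) [Infinite ι] :
    ¬ IsGeneratedBy R (#ι) (ι → R ⧸ m) := by
  let _ := Ideal.Quotient.field m
  intro h
  have := rank_le_of_isGeneratedBy m h
  rw [rank_fun_infinite] at this
  refine (Cardinal.cantor #ι).not_ge (le_trans ?_ this)
  rw [← Cardinal.power_def]
  exact Cardinal.power_le_power_right (Cardinal.two_le_iff.mpr (exists_pair_ne _))

end ResidueField

end IsGeneratedBy

section

open Cardinal

/-! ### Cardinal bounds on Ext into a finite module -/

section ExtGenerators

variable {R : Type u} [CommRing R] [IsNoetherianRing R] {κ : Cardinal.{u}}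
  {A B D C : Type u} [AddCommGroup A] [Module R A] [AddCommGroup B] [Module R B]
  [AddCommGroup D] [Module R D] [AddCommGroup C] [Module R C]

/-- `D` is a quotient of `A / ker f`, a submodule of `B`. This bounds subquotients without
constructing a map from a submodule of `B`. -/
lemma IsGeneratedBy.of_ker_le (hκ : ℵ₀ ≤ κ) (hB : IsGeneratedBy R κ B) (f : A →ₗ[R] B)
    (g : A →ₗ[R] D) (hg : Function.Surjective g) (h : LinearMap.ker f ≤ LinearMap.ker g) :
    IsGeneratedBy R κ D := by
  have h1 : IsGeneratedBy R κ (A ⧸ LinearMap.ker f) :=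
    (hB.submodule hκ (LinearMap.range f)).congr f.quotKerEquivRange.symm
  refine h1.of_surjective ((LinearMap.ker f).liftQ g h) fun y => ?_
  obtain ⟨x, rfl⟩ := hg y
  exact ⟨(LinearMap.ker f).mkQ x, by simp⟩

namespace ExtMod

variable {f : A →ₗ[R] B} {g : B →ₗ[R] D}

lemma isGeneratedBy_mid (hκ : ℵ₀ ≤ κ) (hf : Function.Injective f) (hg : Function.Surjective g)
    (h : Function.Exact f g) {i : ℕ} (hA : IsGeneratedBy R κ (ExtMod R A C i))
    (hD : IsGeneratedBy R κ (ExtMod R D C i)) : IsGeneratedBy R κ (ExtMod R B C i) :=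
  .of_exact hκ (exact_map hf hg h i) hD hA

lemma isGeneratedBy_left (hκ : ℵ₀ ≤ κ) (hf : Function.Injective f) (hg : Function.Surjective g)
    (h : Function.Exact f g) {i : ℕ} (hB : IsGeneratedBy R κ (ExtMod R B C i))
    (hD : IsGeneratedBy R κ (ExtMod R D C (i + 1))) : IsGeneratedBy R κ (ExtMod R A C i) := by
  obtain ⟨δ, h1, -⟩ := exists_connecting (C := C) hf hg h i
  exact .of_exact hκ h1 hB hD

lemma isGeneratedBy_right (hκ : ℵ₀ ≤ κ) (hf : Function.Injective f) (hg : Function.Surjective g)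
    (h : Function.Exact f g) {i : ℕ} (hA : IsGeneratedBy R κ (ExtMod R A C i))
    (hB : IsGeneratedBy R κ (ExtMod R B C (i + 1))) :
    IsGeneratedBy R κ (ExtMod R D C (i + 1)) := by
  obtain ⟨δ, -, h1⟩ := exists_connecting (C := C) hf hg h i
  exact .of_exact hκ h1 hA hB

end ExtMod

omit [IsNoetherianRing R] in
lemma IsGeneratedBy.of_subsingleton (h : Subsingleton A) : IsGeneratedBy R κ A :=
  ⟨∅, by simp, Subsingleton.elim _ _⟩

variable (m : Ideal R) [m.IsMaximal]

omit [IsNoetherianRing R] in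
lemma exists_equiv_fin_of_maximal [Module.Finite R A] (h : ∀ r ∈ m, ∀ x : A, r • x = 0) :
    ∃ n : ℕ, Nonempty (A ≃ₗ[R] (Fin n → R ⧸ m)) := by
  let _ := Ideal.Quotient.field m
  let _ : Module (R ⧸ m) A := Module.IsTorsionBySet.module (I := m) fun x r => h r r.2 x
  have : IsScalarTower R (R ⧸ m) A := Module.IsTorsionBySet.isScalarTower _
  have : Module.Finite (R ⧸ m) A := Module.Finite.of_restrictScalars_finite R _ _
  exact ⟨_, ⟨(Module.finBasis (R ⧸ m) A).equivFun.restrictScalars R⟩⟩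

omit [IsNoetherianRing R] [m.IsMaximal] in
lemma ExtMod.smul_eq_zero_of_mem {i : ℕ} (r : R) (hr : r ∈ m) (x : ExtMod R (R ⧸ m) C i) :
    r • x = 0 :=
  ExtMod.smul_eq_zero (fun y => by
    obtain ⟨y, rfl⟩ := Ideal.Quotient.mk_surjective y
    rw [← Ideal.Quotient.mk_eq_mk, ← Submodule.Quotient.mk_smul]
    exact (Submodule.Quotient.mk_eq_zero _).mpr (m.mul_mem_right y hr)) i x

/-- `Ext^i(k, C)` is some `k^n`, so `Ext^i(k^(ι), C)` is a product of copies of `k^n`, that is,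
`(k^ι)^n`. -/
lemma ExtMod.isGeneratedBy_finsupp [Module.Finite R C] (hκ : ℵ₀ ≤ κ) {ι : Type u}
    (h : IsGeneratedBy R κ (ι → R ⧸ m)) (i : ℕ) :
    IsGeneratedBy R κ (ExtMod R (ι →₀ R ⧸ m) C i) := by
  obtain ⟨n, ⟨e⟩⟩ := exists_equiv_fin_of_maximal m (A := ExtMod R (R ⧸ m) C i)
    (ExtMod.smul_eq_zero_of_mem m)
  let e' : (ι → Fin n → R ⧸ m) ≃ₗ[R] (Fin n → ι → R ⧸ m) :=
    { Equiv.piComm _ with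
      map_add' := fun _ _ => rfl
      map_smul' := fun _ _ => rfl }
  have h1 : IsGeneratedBy R κ (ι → ExtMod R (R ⧸ m) C i) :=
    (h.pi hκ (n := n)).congr (e'.symm.trans (LinearEquiv.piCongrRight fun _ => e.symm))
  exact h1.of_injective hκ _ (ExtMod.bijective_finsupp (R ⧸ m) ι i C).1

/-- Now `n > 0`, so `(k^n)^ι` projects onto `k^ι`. -/
lemma ExtMod.isGeneratedBy_pi_of_finsupp [Module.Finite R C] {ι : Type u} {i : ℕ}
    [Nontrivial (ExtMod R (R ⧸ m) C i)] (h : IsGeneratedBy R κ (ExtMod R (ι →₀ R ⧸ m) C i)) :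
    IsGeneratedBy R κ (ι → R ⧸ m) := by
  obtain ⟨n, ⟨e⟩⟩ := exists_equiv_fin_of_maximal m (A := ExtMod R (R ⧸ m) C i)
    (ExtMod.smul_eq_zero_of_mem m)
  have hn : 0 < n := by
    rcases Nat.eq_zero_or_pos n with rfl | hn
    · exact absurd e.toEquiv.subsingleton (not_subsingleton _)
    · exact hn
  have h1 := (h.of_surjective _ (ExtMod.bijective_finsupp (R ⧸ m) ι i C).2).congr
    (LinearEquiv.piCongrRight fun _ => e)
  refine h1.of_surjective (LinearMap.pi fun a => LinearMap.proj ⟨0, hn⟩ ∘ₗ LinearMap.proj a)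
    fun y => ⟨fun a _ => y a, rfl⟩

/-- Otherwise `C = mC`, and Nakayama produces an element of `1 + m` annihilating `C`, hence lying in
`m`. -/
lemma ExtMod.exists_nontrivial_residueField [Module.Finite R C] (h : Module.annihilator R C ≤ m) :
    ∃ t, Nontrivial (ExtMod R (R ⧸ m) C t) := by
  by_contra! hc
  have h1 := ExtMod.annihilator_smul_top_of_forall_subsingleton (N := R ⧸ m) (C := C) hc
  rw [Ideal.annihilator_quotient] at h1
  obtain ⟨r, hr, hr0⟩ := Submodule.exists_sub_one_mem_and_smul_eq_zero_of_fg_of_le_smul m ⊤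
    Module.Finite.fg_top h1.ge
  have hrm : r ∈ m := h (Module.mem_annihilator.mpr fun c => hr0 c trivial)
  exact ‹m.IsMaximal›.ne_top ((Ideal.eq_top_iff_one m).mpr (by simpa using m.sub_mem hrm hr))

end ExtGenerators

/-! ### Finiteness of homology for complexes with controlled dual -/

/-- A differential module with a (not necessarily spanning) ℤ-grading, i.e. a chain complex whose
terms are submodules of one module. -/
structure GradedDifferential (R : Type u) [CommRing R] (T : Type u) [AddCommGroup T]
    [Module R T] where
  d : T →ₗ[R] T
  Y : ℤ → Submodule R T
  d_d : ∀ x, d (d x) = 0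
  d_mem : ∀ q, ∀ x ∈ Y (q + 1), d x ∈ Y q

namespace GradedDifferential

section

variable {R : Type u} [CommRing R] {T : Type u} [AddCommGroup T] [Module R T]
  (K : GradedDifferential R T)

/-- boundaries -/
def B (q : ℤ) : Submodule R T := (K.Y (q + 1)).map K.d

/-- cycles -/
def Z (q : ℤ) : Submodule R T := K.Y q ⊓ LinearMap.ker K.d

lemma B_le_Y (q : ℤ) : K.B q ≤ K.Y q := by
  rintro _ ⟨x, hx, rfl⟩
  exact K.d_mem q x hx

lemma Z_le_Y (q : ℤ) : K.Z q ≤ K.Y q := inf_le_left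

/-- the cokernel of the differential with values in degree `q` -/
abbrev W (q : ℤ) : Type u := K.Y q ⧸ (K.B q).submoduleOf (K.Y q)

/-- homology -/
abbrev H (q : ℤ) : Type u := K.Z q ⧸ (K.B q).submoduleOf (K.Z q)

/-- inclusion of homology in the cokernel -/
def homologyToW (q : ℤ) : K.H q →ₗ[R] K.W q :=
  Submodule.mapQ _ _ (Submodule.inclusion (K.Z_le_Y q)) fun _ hx => hx

/-- the map induced by the differential -/
def WToB (q : ℤ) : K.W (q + 1) →ₗ[R] K.B q :=
  Submodule.liftQ _ ((K.d.domRestrict (K.Y (q + 1))).codRestrict (K.B q)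
    fun x => ⟨x, x.2, rfl⟩) fun x hx => by
      obtain ⟨y, -, hy⟩ := hx
      refine LinearMap.mem_ker.mpr (Subtype.ext ?_)
      change K.d (x : T) = 0
      rw [show (x : T) = K.d y from hy.symm, K.d_d]

lemma homologyToW_injective (q : ℤ) : Function.Injective (K.homologyToW q) := by
  refine (injective_iff_map_eq_zero _).mpr fun x hx => ?_
  obtain ⟨x, rfl⟩ := Submodule.mkQ_surjective _ x
  exact (Submodule.Quotient.mk_eq_zero _).mpr ((Submodule.Quotient.mk_eq_zero _).mp hx :)

lemma WToB_surjective (q : ℤ) : Function.Surjective (K.WToB q) := by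
  rintro ⟨_, x, hx, rfl⟩
  exact ⟨Submodule.Quotient.mk ⟨x, hx⟩, rfl⟩

/-- This sequence `0 → H → W → B → 0` and `0 → B → Y → W → 0` from `exact_inclusion_mkQ` carry all
the comparisons of `Ext` in `finite_homology`. -/
lemma exact_homologyToW_WToB (q : ℤ) :
    Function.Exact (K.homologyToW (q + 1)) (K.WToB q) := by
  intro x
  obtain ⟨x, rfl⟩ := Submodule.mkQ_surjective _ x
  constructor
  · intro hx
    exact ⟨Submodule.Quotient.mk ⟨x, x.2, congrArg Subtype.val hx⟩, rfl⟩
  · rintro ⟨y, hy⟩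
    rw [← hy]
    obtain ⟨y, rfl⟩ := Submodule.mkQ_surjective _ y
    exact Subtype.ext y.2.2

lemma exact_inclusion_mkQ (q : ℤ) : Function.Exact (Submodule.inclusion (K.B_le_Y q))
    ((K.B q).submoduleOf (K.Y q)).mkQ := by
  intro x
  rw [← LinearMap.mem_ker, Submodule.ker_mkQ]
  constructor
  · exact fun hx => ⟨⟨x, hx⟩, rfl⟩
  · rintro ⟨y, rfl⟩; exact y.2

end

variable {R : Type u} [CommRing R] [IsNoetherianRing R] {T : Type u} [AddCommGroup T] [Module R T]
  (K : GradedDifferential R T) {C : Type u} [AddCommGroup C] [Module R C] [Module.Finite R C]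

/-- The homology of a bounded `Hom(-, C)`-acyclic complex is finitely generated when it is
annihilated by a maximal ideal `m` and controls the cohomology of the `C`-dual complex. -/
theorem finite_homology (m : Ideal R) [m.IsMaximal] (hm : Module.annihilator R C ≤ m) (e : ℤ)
    (hneg : ∀ q < 0, K.Y q = ⊥) (hbig : ∀ q > e, K.Y q = ⊥)
    (hacyc : ∀ q i, Subsingleton (ExtMod R (K.Y q) C (i + 1)))
    (hkill : ∀ r ∈ m, ∀ q, ∀ x : K.H q, r • x = 0)
    (f : ∀ q, (K.W (q + 1) →ₗ[R] C) →ₗ[R] K.H (e - (q + 1)))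
    (hf : ∀ q ψ, f q ψ = 0 → ∃ w : K.Y q →ₗ[R] C, ∀ x : K.Y (q + 1),
      ψ (Submodule.Quotient.mk x) = w ⟨K.d x, K.d_mem q x x.2⟩)
    (q : ℤ) : Module.Finite R (K.H q) := by
  choose ι hι using fun q => exists_equiv_finsupp_of_maximal m (K.H q)
    (fun r hr x => hkill r hr q x)
  have ε : ∀ q, K.H q ≃ₗ[R] (ι q →₀ R ⧸ m) := fun q => (hι q).some
  have hbot : ∀ q, K.Y q = ⊥ → IsEmpty (ι q) := fun q hq => by
    by_contra hne
    rw [not_isEmpty_iff] at hne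
    have : Subsingleton (K.Z q) := by
      have : K.Z q = ⊥ := le_bot_iff.mp (hq ▸ K.Z_le_Y q)
      rw [this]; infer_instance
    have h1 : Subsingleton (K.H q) := (Submodule.mkQ_surjective _).subsingleton
    have h2 : Subsingleton (ι q →₀ R ⧸ m) := (ε q).symm.toEquiv.subsingleton
    exact not_subsingleton _ h2
  by_cases hfin : ∀ q, Finite (ι q)
  · have := hfin q
    exact Module.Finite.equiv (ε q).symm
  exfalso
  push Not at hfin
  obtain ⟨q₁, hq₁⟩ := hfin
  have hrange : ∀ q, Infinite (ι q) → q ∈ Finset.Icc 0 e := fun q hq => by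
    rw [Finset.mem_Icc]
    constructor
    · by_contra! hlt
      exact (hbot q (hneg q hlt)).elim (Classical.arbitrary _)
    · by_contra! hlt
      exact (hbot q (hbig q hlt)).elim (Classical.arbitrary _)
  obtain ⟨q₂, hq₂, hmax⟩ := Finset.exists_max_image (Finset.Icc 0 e) (fun q => #(ι q))
    ⟨q₁, hrange q₁ hq₁⟩
  have hinf : Infinite (ι q₂) := infinite_iff.mpr
    ((infinite_iff.mp hq₁).trans (hmax q₁ (hrange q₁ hq₁)))
  -- The largest rank of a homology module, infinite by assumption: every homology module is
  -- `κ`-generated, but `k^ι` is not for `ι = ι q₂`.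
  set κ := #(ι q₂) with hκdef
  have hκ : ℵ₀ ≤ κ := infinite_iff.mp hinf
  have hle : ∀ q, #(ι q) ≤ κ := fun q => by
    rcases finite_or_infinite (ι q) with h | h
    · exact (mk_lt_aleph0_iff.mpr h).le.trans hκ
    · exact hmax q (hrange q h)
  have hH : ∀ q, IsGeneratedBy R κ (K.H q) := fun q =>
    ((isGeneratedBy_finsupp_iff m).mpr (hle q)).congr (ε q).symm
  -- the smallest degree in which the dual of the homology is large
  obtain ⟨q₀, hq₀, hmin⟩ : ∃ p : ℤ, ¬ IsGeneratedBy R κ (ι (p + 1) → R ⧸ m) ∧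
      ∀ q, q ≤ p → IsGeneratedBy R κ (ι q → R ⧸ m) := by
    obtain ⟨p, hp, hpm⟩ := Int.exists_least_of_bdd
      (P := fun q => ¬ IsGeneratedBy R κ (ι q → R ⧸ m)) ⟨0, fun q hq => by
        by_contra! hlt
        have := hbot q (hneg q hlt)
        exact hq (.of_subsingleton inferInstance)⟩ ⟨q₂, not_isGeneratedBy_pi m _⟩
    refine ⟨p - 1, by rwa [sub_add_cancel], fun q hq => ?_⟩
    by_contra hcon
    have := hpm q hcon
    lia
  have hExtH : ∀ q ≤ q₀, ∀ i, IsGeneratedBy R κ (ExtMod R (K.H q) C i) := fun q hq i =>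
    (ExtMod.isGeneratedBy_finsupp m hκ (hmin q hq) i).congr (ExtMod.congr C (ε q) i)
  -- Induction on the degree: acyclicity of `Y` embeds `Ext^{i+1}(B_q, C)` in `Ext^{i+2}(W_q, C)`,
  -- which lies between the `Ext^{i+2}` of `B_{q-1}` and of `H_q`.
  have hExtB : ∀ q ≤ q₀, ∀ i, IsGeneratedBy R κ (ExtMod R (K.B q) C (i + 1)) := by
    have hzero : ∀ q < 0, ∀ i, IsGeneratedBy R κ (ExtMod R (K.B q) C (i + 1)) := fun q hq i => by
      have hB : K.B q = ⊥ := le_bot_iff.mp (hneg q hq ▸ K.B_le_Y q)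
      have : Subsingleton (K.B q) := by rw [hB]; infer_instance
      exact .of_subsingleton (ExtMod.subsingleton_of_projective _ _ _)
    intro q hq
    rcases lt_or_ge q 0 with hneg' | hnn
    · exact hzero q hneg'
    · have : -1 ≤ q := by lia
      induction q, this using Int.leInduction with
      | base => exact hzero (-1) (by norm_num)
      | succ p hp ih =>
        intro i
        have ihp : ∀ i, IsGeneratedBy R κ (ExtMod R (K.B p) C (i + 1)) := by
          rcases lt_or_ge p 0 with h | h
          · exact hzero p h
          · exact ih (by lia) h
        refine ExtMod.isGeneratedBy_left hκ (Submodule.inclusion_injective (K.B_le_Y (p + 1)))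
          (Submodule.mkQ_surjective _) (K.exact_inclusion_mkQ (p + 1))
          (.of_subsingleton (hacyc _ _)) ?_
        exact ExtMod.isGeneratedBy_mid hκ (K.homologyToW_injective (p + 1)) (K.WToB_surjective p)
          (K.exact_homologyToW_WToB p) (hExtH _ hq _) (ihp _)
  classical
  have hex := ExtMod.exists_nontrivial_residueField (C := C) m hm
  obtain ⟨t, ht, htmin⟩ : ∃ t, Nontrivial (ExtMod R (R ⧸ m) C t) ∧
      ∀ s < t, Subsingleton (ExtMod R (R ⧸ m) C s) :=
    ⟨Nat.find hex, Nat.find_spec hex, fun s hs =>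
      not_nontrivial_iff_subsingleton.mp (Nat.find_min hex hs)⟩
  -- The contradiction will come from bounding this module by `κ`. Minimality of `t` kills the lower
  -- `Ext` of all homology modules, so that only controlled terms intervene.
  have hlarge : ¬ IsGeneratedBy R κ (ExtMod R (K.H (q₀ + 1)) C t) := fun h =>
    hq₀ (ExtMod.isGeneratedBy_pi_of_finsupp m (h.congr (ExtMod.congr C (ε _) t).symm))
  have hsmallH : ∀ s < t, ∀ q, Subsingleton (ExtMod R (K.H q) C s) := fun s hs q => by
    have h1 := htmin s hs
    have h2 : Subsingleton (ExtMod R (ι q →₀ R ⧸ m) C s) :=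
      (ExtMod.bijective_finsupp (R ⧸ m) (ι q) s C).1.subsingleton
    exact ExtMod.subsingleton_congr (ε q) h2
  rcases t with _ | t
  · refine hlarge ?_
    obtain ⟨δ, h1, -⟩ := ExtMod.exists_connecting (C := C) (K.homologyToW_injective (q₀ + 1))
      (K.WToB_surjective q₀) (K.exact_homologyToW_WToB q₀) 0
    have h1' : Function.Exact
        (LinearMap.range (ExtMod.map C (K.homologyToW (q₀ + 1)) 0)).subtype δ := fun x => by
      rw [h1 x]; simp
    refine .of_exact hκ h1' ?_ (hExtB q₀ le_rfl 0)
    -- A functional on `W` with zero class factors through `d`, so it vanishes on cycles. The image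
    -- of `Hom(W, C)` in `Hom(H, C)` is thus a subquotient of homology in the dual degree.
    refine (hH (e - (q₀ + 1))).of_ker_le hκ
      (f q₀ ∘ₗ (ExtMod.zeroEquiv R (K.W (q₀ + 1)) C).toLinearMap)
      (ExtMod.map C (K.homologyToW (q₀ + 1)) 0).rangeRestrict
      (LinearMap.surjective_rangeRestrict _) fun x hx => ?_
    obtain ⟨w, hw⟩ := hf q₀ _ hx
    rw [LinearMap.mem_ker]
    refine Subtype.ext ((ExtMod.zeroEquiv R _ C).injective ?_)
    change ExtMod.zeroEquiv R _ C (ExtMod.map C _ 0 x) = ExtMod.zeroEquiv R _ C 0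
    rw [ExtMod.zeroEquiv_map, map_zero]
    ext y
    refine (hw ⟨y, y.2.1⟩).trans ?_
    have : (⟨K.d y, K.d_mem q₀ y y.2.1⟩ : K.Y q₀) = 0 := Subtype.ext y.2.2
    rw [this, map_zero]; rfl
  · have hExtW : ∀ s, s ≤ t → ∀ q, IsGeneratedBy R κ (ExtMod R (K.W q) C (s + 1)) := by
      intro s
      induction s with
      | zero =>
        intro _ q
        obtain ⟨δ, h1, h2⟩ := ExtMod.exists_connecting (C := C)
          (Submodule.inclusion_injective (K.B_le_Y q))
          (Submodule.mkQ_surjective _) (K.exact_inclusion_mkQ q) 0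
        have hδ : Function.Surjective δ := fun x => (h2 x).mp ((hacyc q 0).elim _ _)
        -- `Ext^1(W_q, C)` consists of functionals on `B_q` modulo those extending to `Y_q`; a
        -- functional whose pullback to `W_{q+1}` has zero class does extend.
        refine (hH (e - (q + 1))).of_ker_le hκ
          (f q ∘ₗ LinearMap.lcomp R C (K.WToB q) ∘ₗ (ExtMod.zeroEquiv R (K.B q) C).toLinearMap)
          δ hδ fun x hx => ?_
        obtain ⟨w, hw⟩ := hf q _ hx
        refine LinearMap.mem_ker.mpr ((h1 x).mpr ⟨(ExtMod.zeroEquiv R _ C).symm w, ?_⟩)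
        rw [ExtMod.map_zeroEquiv_symm, LinearEquiv.symm_apply_eq]
        ext ⟨_, y, hy, rfl⟩
        exact (hw ⟨y, hy⟩).symm
      | succ s ih =>
        intro hs q
        -- Shift through `B_q`: since `Ext^s(H_{q+1}, C) = 0`, the module `Ext^{s+1}(B_q, C)` embeds
        -- in `Ext^{s+1}(W_{q+1}, C)` and maps onto `Ext^{s+2}(W_q, C)`.
        refine ExtMod.isGeneratedBy_right hκ (Submodule.inclusion_injective (K.B_le_Y q))
          (Submodule.mkQ_surjective _) (K.exact_inclusion_mkQ q) ?_ (.of_subsingleton (hacyc _ _))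
        exact ExtMod.isGeneratedBy_right hκ (K.homologyToW_injective (q + 1)) (K.WToB_surjective q)
          (K.exact_homologyToW_WToB q) (.of_subsingleton (hsmallH s (by lia) _))
          (ih (by lia) (q + 1))
    exact hlarge (ExtMod.isGeneratedBy_left hκ (K.homologyToW_injective (q₀ + 1))
      (K.WToB_surjective q₀) (K.exact_homologyToW_WToB q₀) (hExtW t le_rfl _)
      (hExtB q₀ le_rfl _))

end GradedDifferential

end

/-! ### Self-dual Koszul complexes as iterated mapping cones -/

namespace GradedDifferential

variable {R : Type u} [CommRing R] {T : Type u} [AddCommGroup T] [Module R T]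

/-- A module placed in degree zero. -/
def single (R : Type u) [CommRing R] (T : Type u) [AddCommGroup T] [Module R T] :
    GradedDifferential R T where
  d := 0
  Y q := if q = 0 then ⊤ else ⊥
  d_d _ := rfl
  d_mem _ _ _ := zero_mem _

lemma single_Y_zero : (single R T).Y 0 = ⊤ := by simp [single]

lemma single_Y_of_ne {q : ℤ} (h : q ≠ 0) : (single R T).Y q = ⊥ := if_neg h

variable (K : GradedDifferential R T) (r : R)

/-- The mapping cone of multiplication by `r`. -/
def cone : GradedDifferential R (T × T) where
  d :=
    { toFun x := (K.d x.1 + r • x.2, -K.d x.2)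
      map_add' x y := by ext <;> simp; all_goals abel
      map_smul' c x := by ext <;> simp [smul_comm c r] }
  Y q := (K.Y q).prod (K.Y (q - 1))
  d_d x := by simp [K.d_d]
  d_mem q x hx := by
    have h2 : x.2 ∈ K.Y q := by simpa using hx.2
    exact ⟨add_mem (K.d_mem q _ hx.1) (Submodule.smul_mem _ _ h2),
      neg_mem (K.d_mem (q - 1) _ (by simpa using h2))⟩

lemma cone_d (x : T × T) : (K.cone r).d x = (K.d x.1 + r • x.2, -K.d x.2) := rfl

lemma cone_Y (q : ℤ) : (K.cone r).Y q = (K.Y q).prod (K.Y (q - 1)) := rfl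

/-- first inclusion into a term of the cone -/
def coneInl (q : ℤ) : K.Y q →ₗ[R] (K.cone r).Y q :=
  (LinearMap.inl R _ _ ∘ₗ (K.Y q).subtype).codRestrict _ fun x => ⟨x.2, zero_mem _⟩

/-- second inclusion into a term of the cone -/
def coneInr (q : ℤ) : K.Y (q - 1) →ₗ[R] (K.cone r).Y q :=
  (LinearMap.inr R _ _ ∘ₗ (K.Y (q - 1)).subtype).codRestrict _ fun x => ⟨zero_mem _, x.2⟩

/-- second projection from a term of the cone -/
def coneSnd (q : ℤ) : (K.cone r).Y q →ₗ[R] K.Y (q - 1) :=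
  (LinearMap.snd R _ _ ∘ₗ Submodule.subtype _).codRestrict _ fun x => x.2.2

end GradedDifferential

/-- The data carried along the construction of the Koszul complex on `rs` with coefficients in a
module `S` that is self-dual with respect to `Hom(-, C)`. -/
structure SelfDualKoszul (R : Type u) [CommRing R] (S : Type u) [AddCommGroup S] [Module R S]
    (C : Type u) [AddCommGroup C] [Module R C] (rs : List R) where
  T : Type u
  [addCommGroup : AddCommGroup T]
  [module : Module R T]
  K : GradedDifferential R T
  e : ℤ
  neg : ∀ q < 0, K.Y q = ⊥
  big : ∀ q > e, K.Y q = ⊥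
  acyclic : ∀ q i, Subsingleton (ExtMod R (K.Y q) C (i + 1))
  β : T →ₗ[R] T →ₗ[R] C
  σ : R
  σ_mul_σ : σ * σ = 1
  adjoint : ∀ x y, β (K.d x) y = σ • β x (K.d y)
  injective : ∀ p q, p + q = e → ∀ y ∈ K.Y p, (∀ x ∈ K.Y q, β x y = 0) → y = 0
  surjective : ∀ p q, p + q = e → ∀ φ : K.Y q →ₗ[R] C, ∃ y ∈ K.Y p, ∀ x : K.Y q, β x y = φ x
  homotopy : ∀ r ∈ rs, ∃ h : T →ₗ[R] T, (∀ q, ∀ x ∈ K.Y q, h x ∈ K.Y (q + 1)) ∧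
    ∀ x, K.d (h x) + h (K.d x) = r • x
  π : T →ₗ[R] S
  π_surjective : ∀ s, ∃ x ∈ K.Y 0, π x = s
  π_d : ∀ x, π (K.d x) ∈ Ideal.span {r | r ∈ rs} • (⊤ : Submodule R S)

attribute [instance] SelfDualKoszul.addCommGroup SelfDualKoszul.module

namespace SelfDualKoszul

variable {R : Type u} [CommRing R] {S : Type u} [AddCommGroup S] [Module R S]
  {C : Type u} [AddCommGroup C] [Module R C]

/-- The Koszul complex on the empty sequence. -/
def nil (β : S →ₗ[R] S →ₗ[R] C) (hβ : Function.Bijective β.flip)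
    (hext : ∀ i, Subsingleton (ExtMod R S C (i + 1))) : SelfDualKoszul R S C [] where
  T := S
  K := .single R S
  e := 0
  neg q hq := if_neg hq.ne
  big q hq := if_neg (ne_of_gt hq)
  acyclic q i := by
    by_cases hq : q = 0
    · rw [hq, GradedDifferential.single_Y_zero]
      exact ExtMod.subsingleton_congr Submodule.topEquiv (hext i)
    · rw [GradedDifferential.single_Y_of_ne hq]
      exact ExtMod.subsingleton_of_projective _ _ _
  β := β
  σ := 1
  σ_mul_σ := one_mul 1
  adjoint x y := by simp [GradedDifferential.single]
  injective p q h y hy hx := by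
    by_cases hq : q = 0
    · refine (injective_iff_map_eq_zero _).mp hβ.1 y (LinearMap.ext fun x => hx x ?_)
      simp [hq, GradedDifferential.single_Y_zero]
    · have hp : p ≠ 0 := by lia
      rwa [GradedDifferential.single_Y_of_ne hp, Submodule.mem_bot] at hy
  surjective p q h φ := by
    by_cases hq : q = 0
    · subst hq
      obtain rfl : p = 0 := by lia
      obtain ⟨y, hy⟩ := hβ.2
        (φ ∘ₗ (LinearEquiv.ofTop _ GradedDifferential.single_Y_zero).symm.toLinearMap)
      refine ⟨y, by rw [GradedDifferential.single_Y_zero]; trivial, fun x => ?_⟩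
      exact (LinearMap.congr_fun hy x.1)
    · refine ⟨0, zero_mem _, fun x => ?_⟩
      have hx : x = 0 := Subtype.ext
        ((Submodule.mem_bot R).mp ((GradedDifferential.single_Y_of_ne hq).le x.2))
      simp [hx]
  homotopy r hr := by simp at hr
  π := LinearMap.id
  π_surjective s := ⟨s, by rw [GradedDifferential.single_Y_zero]; trivial, rfl⟩
  π_d x := by simp [GradedDifferential.single]

/-- The duality pairing on a mapping cone. -/
def conePairing {T : Type u} [AddCommGroup T] [Module R T] (β : T →ₗ[R] T →ₗ[R] C) (σ : R) :
    T × T →ₗ[R] T × T →ₗ[R] C :=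
  LinearMap.mk₂ R (fun x y => β x.1 y.2 - σ • β x.2 y.1)
    (fun x x' y => by simp; abel) (fun c x y => by simp [smul_sub, smul_comm c σ])
    (fun x y y' => by simp; abel) (fun c x y => by simp [smul_sub, smul_comm c σ])

lemma conePairing_apply {T : Type u} [AddCommGroup T] [Module R T] (β : T →ₗ[R] T →ₗ[R] C)
    (σ : R) (x y : T × T) : conePairing β σ x y = β x.1 y.2 - σ • β x.2 y.1 := rfl

/-- The mapping cone of multiplication by `r` on a Koszul complex. -/
def cons {rs : List R} (D : SelfDualKoszul R S C rs) (r : R) : SelfDualKoszul R S C (r :: rs) where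
  T := D.T × D.T
  K := D.K.cone r
  e := D.e + 1
  neg q hq := by rw [GradedDifferential.cone_Y, D.neg q hq, D.neg (q - 1) (by lia),
    Submodule.prod_bot]
  big q hq := by rw [GradedDifferential.cone_Y, D.big q (by lia), D.big (q - 1) (by lia),
    Submodule.prod_bot]
  acyclic q i := by
    refine ExtMod.subsingleton_mid (f := D.K.coneInl r q) (g := D.K.coneSnd r q)
      (fun x y h => ?_) (fun y => ?_) (fun x => ?_) (D.acyclic _ _) (D.acyclic _ _)
    · exact Subtype.ext (congrArg (fun z => (z.1 : D.T × D.T).1) h)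
    · exact ⟨⟨(0, y), zero_mem _, y.2⟩, rfl⟩
    · constructor
      · intro h
        have h2 : (x.1 : D.T × D.T).2 = 0 := congrArg Subtype.val h
        exact ⟨⟨x.1.1, x.2.1⟩, Subtype.ext (Prod.ext rfl h2.symm)⟩
      · rintro ⟨y, rfl⟩; rfl
  β := conePairing D.β D.σ
  -- The sign on the second component of the cone differential makes the adjunction sign independent
  -- of degree; it flips with each cone.
  σ := -D.σ
  σ_mul_σ := by rw [neg_mul_neg, D.σ_mul_σ]
  adjoint x y := by
    have h1 : ∀ c : C, D.σ • D.σ • c = c := fun c => by rw [smul_smul, D.σ_mul_σ, one_smul]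
    simp only [conePairing_apply, GradedDifferential.cone_d, map_add, map_neg, map_smul,
      LinearMap.add_apply, LinearMap.neg_apply, LinearMap.smul_apply, D.adjoint, neg_smul,
      smul_neg, smul_add, smul_sub, neg_neg, h1]
    abel
  injective p q h y hy hx := by
    refine Prod.ext (D.injective p (q - 1) (by lia) _ hy.1 fun b hb => ?_)
      (D.injective (p - 1) q (by lia) _ hy.2 fun a ha => ?_)
    · have := hx (0, b) ⟨zero_mem _, hb⟩
      rw [conePairing_apply, map_zero, LinearMap.zero_apply, zero_sub, neg_eq_zero] at this
      rw [← one_smul R (D.β b y.1), ← D.σ_mul_σ, mul_smul, this, smul_zero]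
    · have := hx (a, 0) ⟨ha, zero_mem _⟩
      rwa [conePairing_apply, map_zero, LinearMap.zero_apply, smul_zero, sub_zero] at this
  surjective p q h φ := by
    obtain ⟨b, hb, hb'⟩ := D.surjective (p - 1) q (by lia) (φ ∘ₗ D.K.coneInl r q)
    obtain ⟨a, ha, ha'⟩ := D.surjective p (q - 1) (by lia) (-D.σ • (φ ∘ₗ D.K.coneInr r q))
    refine ⟨(a, b), ⟨ha, hb⟩, fun x => ?_⟩
    have hx : x = D.K.coneInl r q ⟨x.1.1, x.2.1⟩ + D.K.coneInr r q ⟨x.1.2, x.2.2⟩ :=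
      Subtype.ext (Prod.ext (add_zero _).symm (zero_add _).symm)
    conv_rhs => rw [hx, map_add]
    rw [conePairing_apply]
    have h1 := hb' ⟨x.1.1, x.2.1⟩
    have h2 := ha' ⟨x.1.2, x.2.2⟩
    simp only [LinearMap.smul_apply, LinearMap.comp_apply] at h1 h2
    rw [h1, h2, smul_smul, mul_neg, D.σ_mul_σ, neg_smul, one_smul, sub_neg_eq_add]
  homotopy s hs := by
    rcases List.mem_cons.mp hs with rfl | hs
    -- On the cone of `r`, the map `(a, b) ↦ (0, a)` is a homotopy from `r` to zero; older
    -- homotopies `h` extend as `(h, -h)`.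
    · refine ⟨LinearMap.inr R _ _ ∘ₗ LinearMap.fst R _ _, fun q x hx => ⟨zero_mem _, ?_⟩,
        fun x => ?_⟩
      · simpa using hx.1
      · ext <;> simp [GradedDifferential.cone_d]
    · obtain ⟨h, hmem, hh⟩ := D.homotopy s hs
      refine ⟨LinearMap.prodMap h (-h), fun q x hx => ⟨hmem _ _ hx.1, neg_mem ?_⟩, fun x => ?_⟩
      · simpa using hmem _ _ hx.2
      · ext
        · simp [GradedDifferential.cone_d, ← hh]; abel
        · simp [GradedDifferential.cone_d, ← hh]
  π := D.π ∘ₗ LinearMap.fst R _ _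
  π_surjective s := by
    obtain ⟨x, hx, rfl⟩ := D.π_surjective s
    exact ⟨(x, 0), ⟨hx, zero_mem _⟩, rfl⟩
  π_d x := by
    have hle : Ideal.span {t | t ∈ rs} ≤ Ideal.span {t | t ∈ r :: rs} :=
      Ideal.span_mono fun t ht => List.mem_cons_of_mem _ ht
    simp only [LinearMap.comp_apply, LinearMap.fst_apply, GradedDifferential.cone_d, map_add,
      map_smul]
    exact add_mem (Submodule.smul_mono_left hle (D.π_d _))
      (Submodule.smul_mem_smul (Ideal.subset_span List.mem_cons_self) trivial)

lemma nonempty (β : S →ₗ[R] S →ₗ[R] C) (hβ : Function.Bijective β.flip)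
    (hext : ∀ i, Subsingleton (ExtMod R S C (i + 1))) (rs : List R) :
    Nonempty (SelfDualKoszul R S C rs) := by
  induction rs with
  | nil => exact ⟨nil β hβ hext⟩
  | cons r rs ih => exact ⟨ih.some.cons r⟩

variable {rs : List R} (D : SelfDualKoszul R S C rs)

/-- Self-duality, degree by degree. -/
noncomputable def dualEquiv (p q : ℤ) (h : p + q = D.e) : D.K.Y p ≃ₗ[R] (D.K.Y q →ₗ[R] C) :=
  LinearEquiv.ofBijective (LinearMap.domRestrict₁₂ D.β (D.K.Y q) (D.K.Y p)).flip
    ⟨(injective_iff_map_eq_zero _).mpr fun y hy => Subtype.ext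
      (D.injective p q h y y.2 fun x hx => LinearMap.congr_fun hy ⟨x, hx⟩),
    fun φ => by
      obtain ⟨y, hy, hφ⟩ := D.surjective p q h φ
      exact ⟨⟨y, hy⟩, LinearMap.ext hφ⟩⟩

lemma dualEquiv_symm_apply (p q : ℤ) (h : p + q = D.e) (φ : D.K.Y q →ₗ[R] C) (x : D.K.Y q) :
    D.β x ((D.dualEquiv p q h).symm φ) = φ x :=
  LinearMap.congr_fun ((D.dualEquiv p q h).apply_symm_apply φ) x

/-- A functional on `W` kills boundaries, so by adjointness the differential of its representing
element pairs to zero with everything; nondegeneracy concludes. -/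
lemma dual_mem_Z (q : ℤ) (ψ : D.K.W (q + 1) →ₗ[R] C) :
    ((D.dualEquiv (D.e - (q + 1)) (q + 1) (by ring)).symm (ψ ∘ₗ Submodule.mkQ _) : D.T) ∈
      D.K.Z (D.e - (q + 1)) := by
  set y := (D.dualEquiv (D.e - (q + 1)) (q + 1) (by ring)).symm (ψ ∘ₗ Submodule.mkQ _) with hy
  refine ⟨y.2, LinearMap.mem_ker.mpr ?_⟩
  refine D.injective (D.e - (q + 1) - 1) (q + 1 + 1) (by ring) _
    (D.K.d_mem _ _ (by rw [sub_add_cancel]; exact y.2)) fun x hx => ?_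
  have h1 := D.adjoint x y
  have h2 : D.β (D.K.d x) y = 0 := by
    rw [hy, D.dualEquiv_symm_apply _ _ _ _ ⟨D.K.d x, D.K.d_mem _ _ hx⟩, LinearMap.comp_apply]
    rw [show (Submodule.mkQ _) (⟨D.K.d x, D.K.d_mem _ _ hx⟩ : D.K.Y (q + 1)) = (0 : D.K.W (q + 1)) from
      (Submodule.Quotient.mk_eq_zero _).mpr ⟨x, hx, rfl⟩, map_zero]
  rw [← one_smul R (D.β x _), ← D.σ_mul_σ, mul_smul, ← h1, h2, smul_zero]

/-- The cohomology class, viewed in homology, of a cocycle of the dual complex. -/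
noncomputable def cocycleClass (q : ℤ) :
    (D.K.W (q + 1) →ₗ[R] C) →ₗ[R] D.K.H (D.e - (q + 1)) :=
  Submodule.mkQ _ ∘ₗ LinearMap.codRestrict _ (Submodule.subtype _ ∘ₗ
    (D.dualEquiv (D.e - (q + 1)) (q + 1) (by ring)).symm.toLinearMap ∘ₗ
    LinearMap.lcomp R C (Submodule.mkQ _)) (D.dual_mem_Z q)

/-- If the representing element is `d z`, adjointness moves `d` across the pairing, and `w` is `σ`
times pairing with `z`. -/
lemma exists_of_cocycleClass_eq_zero (q : ℤ) (ψ : D.K.W (q + 1) →ₗ[R] C)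
    (h : D.cocycleClass q ψ = 0) : ∃ w : D.K.Y q →ₗ[R] C, ∀ x : D.K.Y (q + 1),
      ψ (Submodule.Quotient.mk x) = w ⟨D.K.d x, D.K.d_mem q x x.2⟩ := by
  obtain ⟨z, hz, hz'⟩ := (Submodule.Quotient.mk_eq_zero _).mp h
  refine ⟨D.σ • (D.β.flip z).domRestrict (D.K.Y q), fun x => ?_⟩
  have h1 := D.dualEquiv_symm_apply (D.e - (q + 1)) (q + 1) (by ring) (ψ ∘ₗ Submodule.mkQ _) x
  refine h1.symm.trans ?_
  change _ = D.σ • D.β (D.K.d x) z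
  rw [D.adjoint, smul_smul, D.σ_mul_σ, one_smul, hz']
  rfl

/-- The generators `rs` act null-homotopically. -/
lemma smul_homology (r : R) (hr : r ∈ Ideal.span {t | t ∈ rs}) (q : ℤ) (x : D.K.H q) :
    r • x = 0 := by
  induction hr using Submodule.span_induction with
  | mem r hr =>
    obtain ⟨h, hmem, hh⟩ := D.homotopy r hr
    obtain ⟨x, rfl⟩ := Submodule.mkQ_surjective _ x
    rw [← map_smul]
    refine (Submodule.Quotient.mk_eq_zero _).mpr ⟨h x, hmem _ _ x.2.1, ?_⟩
    have := hh x
    rw [show D.K.d x = 0 from x.2.2, map_zero, add_zero] at this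
    exact this
  | zero => exact zero_smul _ _
  | add a b _ _ ha hb => rw [add_smul, ha, hb, add_zero]
  | smul a b _ hb => rw [smul_eq_mul, mul_smul, hb, smul_zero]

end SelfDualKoszul

/-! ### Finiteness of `S` over `R` -/

section FiniteOfSelfDual

variable {R : Type u} [CommRing R] [IsNoetherianRing R] {S : Type u} [AddCommGroup S] [Module R S]
  {C : Type u} [AddCommGroup C] [Module R C] [Module.Finite R C]

/-- The Koszul complex on generators of `m` has finite homology, and its `H_0` maps onto `S/mS`. -/
lemma finite_quotient_of_selfDual (β : S →ₗ[R] S →ₗ[R] C) (hβ : Function.Bijective β.flip)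
    (hext : ∀ i, Subsingleton (ExtMod R S C (i + 1))) (m : Ideal R) [m.IsMaximal]
    (hm : Module.annihilator R C ≤ m) : Module.Finite R (S ⧸ m • (⊤ : Submodule R S)) := by
  obtain ⟨s, hs⟩ := (isNoetherianRing_iff_ideal_fg R).mp inferInstance m
  have hspan : Ideal.span {t | t ∈ s.toList} = m := by
    rw [← hs]; congr 1; ext; simp
  obtain ⟨D⟩ := SelfDualKoszul.nonempty β hβ hext s.toList
  have hfin : Module.Finite R (D.K.H 0) := D.K.finite_homology m hm D.e D.neg D.big D.acyclic
    (fun r hr q x => D.smul_homology r (hspan ▸ hr) q x) D.cocycleClass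
    D.exists_of_cocycleClass_eq_zero 0
  let g : D.K.H 0 →ₗ[R] S ⧸ m • (⊤ : Submodule R S) :=
    Submodule.liftQ _ (Submodule.mkQ _ ∘ₗ D.π ∘ₗ Submodule.subtype _) fun x hx => by
      obtain ⟨y, -, hy⟩ := hx
      refine LinearMap.mem_ker.mpr ((Submodule.Quotient.mk_eq_zero _).mpr ?_)
      have := D.π_d y
      rw [hspan, hy] at this
      exact this
  refine Module.Finite.of_surjective g fun y => ?_
  obtain ⟨y, rfl⟩ := Submodule.mkQ_surjective _ y
  obtain ⟨x, hx, rfl⟩ := D.π_surjective y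
  have hx0 : D.K.d x = 0 := by
    have := D.K.d_mem (-1) x (by simpa using hx)
    rwa [D.neg (-1) (by norm_num), Submodule.mem_bot] at this
  exact ⟨Submodule.Quotient.mk ⟨x, hx, hx0⟩, rfl⟩

/-- A module `S` over a noetherian ring that is `Hom(-, C)`-acyclic and isomorphic to its `C`-dual
is finitely generated. -/
theorem finite_of_selfDual (β : S →ₗ[R] S →ₗ[R] C) (hβ : Function.Bijective β.flip)
    (hext : ∀ i, Subsingleton (ExtMod R S C (i + 1))) : Module.Finite R S := by
  classical
  -- Only one maximal ideal above each of the finitely many associated primes of `C` is needed.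
  have hA : ∀ p : associatedPrimes R C, ∃ (m : Ideal R) (_ : m.IsMaximal), p.1 ≤ m ∧
      ∃ t : Finset S, Submodule.span R (t : Set S) ⊔ m • ⊤ = ⊤ := by
    rintro ⟨p, hp⟩
    obtain ⟨m, hmax, hpm⟩ := Ideal.exists_le_maximal p (IsAssociatedPrime.isPrime hp).ne_top
    have hfin := finite_quotient_of_selfDual β hβ hext m
      (Submodule.annihilator_top.symm.le.trans ((IsAssociatedPrime.annihilator_le hp).trans hpm))
    obtain ⟨t, ht⟩ := hfin.fg_top
    refine ⟨m, hmax, hpm, ?_⟩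
    choose g hg using Submodule.mkQ_surjective (m • (⊤ : Submodule R S))
    refine ⟨t.image g, ?_⟩
    have h1 : (Submodule.span R ((t.image g : Finset S) : Set S)).map (Submodule.mkQ (m • ⊤)) = ⊤ := by
      rw [Submodule.map_span, Finset.coe_image, ← Set.image_comp]
      have : (Submodule.mkQ (m • (⊤ : Submodule R S))) ∘ g = id := funext hg
      rw [this, Set.image_id, ht]
    have h2 := congrArg (Submodule.comap (Submodule.mkQ (m • ⊤))) h1
    rwa [Submodule.comap_map_mkQ, Submodule.comap_top, sup_comm] at h2
  choose m hmax hpm t ht using hA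
  have hfinA : Finite (associatedPrimes R C) := (associatedPrimes.finite R C).to_subtype
  let _ := Fintype.ofFinite (associatedPrimes R C)
  let T : Finset S := Finset.univ.biUnion t
  -- If `φ` vanishes on `T`, then `φ(S) = m φ(S)` for the `m` chosen above an associated prime `p`
  -- of `φ(S)`. Nakayama gives an element of `1 + m` killing `φ(S)`, which then lies in `p ≤ m`.
  have hkey : ∀ φ : S →ₗ[R] C, (∀ x ∈ T, φ x = 0) → φ = 0 := by
    intro φ hφ
    by_contra hne
    have hnt : Nontrivial (LinearMap.range φ) := by
      rw [Submodule.nontrivial_iff_ne_bot]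
      exact fun h => hne (LinearMap.range_eq_bot.mp h)
    obtain ⟨p, hp⟩ := associatedPrimes.nonempty R (LinearMap.range φ)
    have hpC : p ∈ associatedPrimes R C :=
      associatedPrimes.subset_of_injective (LinearMap.range φ).injective_subtype hp
    let p' : associatedPrimes R C := ⟨p, hpC⟩
    have hle : LinearMap.range φ ≤ m p' • LinearMap.range φ := by
      rw [LinearMap.range_eq_map, ← Submodule.map_smul'']
      conv_lhs => rw [← ht p', Submodule.map_sup]
      refine sup_le ?_ le_rfl
      rw [Submodule.map_span, Submodule.span_le]
      rintro _ ⟨x, hx, rfl⟩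
      rw [hφ x (Finset.mem_biUnion.mpr ⟨p', Finset.mem_univ _, hx⟩)]
      exact zero_mem _
    obtain ⟨r, hr, hr0⟩ := Submodule.exists_sub_one_mem_and_smul_eq_zero_of_fg_of_le_smul
      (m p') (LinearMap.range φ) (IsNoetherian.noetherian _) hle
    have hrp : r ∈ p := IsAssociatedPrime.annihilator_le hp
      (Submodule.mem_annihilator.mpr fun c _ => Subtype.ext (hr0 c c.2))
    exact (hmax p').ne_top ((Ideal.eq_top_iff_one _).mpr
      (by simpa using (m p').sub_mem (hpm p' hrp) hr))
  -- Pairing with the elements of `T` embeds `S` in the noetherian module `C^T`.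
  refine Module.Finite.of_injective (LinearMap.pi fun x : T => β x) ?_
  refine (injective_iff_map_eq_zero _).mpr fun s hs => ?_
  refine (injective_iff_map_eq_zero _).mp hβ.1 s (hkey _ fun x hx => ?_)
  exact congrFun hs ⟨x, hx⟩

end FiniteOfSelfDual

/-! ### Complete resolutions as spliced short exact sequences -/

/-- A complete projective resolution cut into short exact sequences
`0 → N (n + 1) → P n → N n → 0`. -/
structure SplicedResolution (S : Type u) [CommRing S] where
  N : ℤ → ModuleCat.{u} S
  P : ℤ → ModuleCat.{u} S
  i : ∀ n, N (n + 1) →ₗ[S] P n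
  p : ∀ n, P n →ₗ[S] N n
  projective : ∀ n, Module.Projective S (P n)
  injective : ∀ n, Function.Injective (i n)
  surjective : ∀ n, Function.Surjective (p n)
  exact : ∀ n, Function.Exact (i n) (p n)
  extends_to_projective : ∀ (Q : Type u) [AddCommGroup Q] [Module S Q] [Module.Projective S Q]
    (n : ℤ) (φ : N (n + 1) →ₗ[S] Q), ∃ ψ : P n →ₗ[S] Q, ψ ∘ₗ i n = φ

section

variable {S : Type u} [CommRing S]

lemma LinearMap.exists_comp_eq_of_ker_le {A B D : Type*} [AddCommGroup A] [Module S A]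
    [AddCommGroup B] [Module S B] [AddCommGroup D] [Module S D] (p : A →ₗ[S] B)
    (hp : Function.Surjective p) (φ : A →ₗ[S] D) (h : LinearMap.ker p ≤ LinearMap.ker φ) :
    ∃ χ : B →ₗ[S] D, χ ∘ₗ p = φ := by
  refine ⟨(LinearMap.ker p).liftQ φ h ∘ₗ (p.quotKerEquivOfSurjective hp).symm.toLinearMap, ?_⟩
  ext x
  have : (p.quotKerEquivOfSurjective hp).symm (p x) = Submodule.Quotient.mk x := by
    rw [LinearEquiv.symm_apply_eq]; rfl
  change (LinearMap.ker p).liftQ φ h ((p.quotKerEquivOfSurjective hp).symm (p x)) = φ x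
  rw [this]; rfl

lemma IsCompleteProjectiveResolution.exists_eq_comp {X : ChainComplex (ModuleCat.{u} S) ℤ}
    (hX : IsCompleteProjectiveResolution X) (Q : ModuleCat.{u} S) (hQ : Projective Q) {k n m : ℤ}
    (hk : n + 1 = k) (hm : n - 1 = m) (φ : X.X n ⟶ Q) (hφ : X.d k n ≫ φ = 0) :
    ∃ ψ : X.X m ⟶ Q, φ = X.d n m ≫ ψ := by
  subst hk hm
  exact hX.hom_exact Q hQ n φ hφ

/-- Cutting a complete projective resolution into short exact sequences. -/
noncomputable def IsCompleteProjectiveResolution.splice {X : ChainComplex (ModuleCat.{u} S) ℤ}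
    (hX : IsCompleteProjectiveResolution X) : SplicedResolution S where
  N n := ModuleCat.of S (X.X n ⧸ LinearMap.range (X.d (n + 1) n).hom)
  P n := X.X n
  i n := Submodule.liftQ _ (X.d (n + 1) n).hom (by
    rintro _ ⟨x, rfl⟩
    exact LinearMap.congr_fun (congrArg ModuleCat.Hom.hom (X.d_comp_d (n + 1 + 1) (n + 1) n)) x)
  p n := Submodule.mkQ _
  projective n := (IsProjective.iff_projective _).mpr (hX.projective n)
  injective n := by
    refine (injective_iff_map_eq_zero _).mpr fun x hx => ?_
    obtain ⟨x, rfl⟩ := Submodule.mkQ_surjective _ x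
    have h1 := (X.exactAt_iff' (n + 1 + 1) (n + 1) n (by simp) (by simp)).mp (hX.exact (n + 1))
    obtain ⟨y, hy⟩ := (ShortComplex.moduleCat_exact_iff _).mp h1 x hx
    exact (Submodule.Quotient.mk_eq_zero _).mpr ⟨y, hy⟩
  surjective n := Submodule.mkQ_surjective _
  exact n := by
    intro x
    rw [← LinearMap.mem_ker, Submodule.ker_mkQ]
    constructor
    · rintro ⟨y, rfl⟩
      exact ⟨Submodule.mkQ _ y, rfl⟩
    · rintro ⟨y, rfl⟩
      obtain ⟨y, rfl⟩ := Submodule.mkQ_surjective _ y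
      exact ⟨y, rfl⟩
  extends_to_projective Q _ _ _ n φ := by
    obtain ⟨ψ, hψ⟩ := hX.exists_eq_comp (ModuleCat.of S Q)
      ((IsProjective.iff_projective _).mp inferInstance) (n := n + 1) rfl (m := n) (by ring)
      (ModuleCat.ofHom (φ ∘ₗ Submodule.mkQ _)) (by
        ext x
        exact (congrArg φ ((Submodule.Quotient.mk_eq_zero _).mpr ⟨x, rfl⟩)).trans (map_zero φ))
    refine ⟨ψ.hom, LinearMap.ext fun x => ?_⟩
    obtain ⟨x, rfl⟩ := Submodule.mkQ_surjective _ x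
    exact (LinearMap.congr_fun (congrArg ModuleCat.Hom.hom hψ) x).symm

lemma IsGorensteinProjective.exists_spliced {M : ModuleCat.{u} S}
    (h : IsGorensteinProjective S M) :
    ∃ D : SplicedResolution S, Nonempty (D.N 0 ≃ₗ[S] M) := by
  obtain ⟨X, hX, ⟨e⟩⟩ := h
  exact ⟨hX.splice, ⟨((ModuleCat.cokernelIsoRangeQuotient _).symm ≪≫ e).toLinearEquiv⟩⟩

namespace SplicedResolution

variable (D : SplicedResolution S)

/-- The complex obtained by splicing the short exact sequences. -/
noncomputable def complex : ChainComplex (ModuleCat.{u} S) ℤ :=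
  ChainComplex.of D.P (fun n => ModuleCat.ofHom (D.i n ∘ₗ D.p (n + 1))) fun n => by
    ext x
    change D.i n (D.p (n + 1) (D.i (n + 1) (D.p (n + 1 + 1) x))) = 0
    rw [(D.exact (n + 1)).apply_apply_eq_zero, map_zero]

lemma complex_d (n : ℤ) :
    D.complex.d (n + 1) n = ModuleCat.ofHom (D.i n ∘ₗ D.p (n + 1)) :=
  ChainComplex.of_d D.P (fun n => ModuleCat.ofHom (D.i n ∘ₗ D.p (n + 1))) n

lemma isCompleteProjectiveResolution : IsCompleteProjectiveResolution D.complex where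
  projective n := (IsProjective.iff_projective _).mp (D.projective n)
  exact n := by
    obtain ⟨n, rfl⟩ : ∃ k, n = k + 1 := ⟨n - 1, by ring⟩
    rw [D.complex.exactAt_iff' (n + 1 + 1) (n + 1) n (by simp) (by simp),
      ShortComplex.moduleCat_exact_iff]
    intro x hx
    change D.complex.d (n + 1) n x = 0 at hx
    rw [complex_d] at hx
    obtain ⟨y, rfl⟩ := (D.exact (n + 1) x).mp
      ((injective_iff_map_eq_zero _).mp (D.injective n) _ hx)
    obtain ⟨z, rfl⟩ := D.surjective (n + 1 + 1) y
    refine ⟨z, ?_⟩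
    change D.complex.d (n + 1 + 1) (n + 1) z = _
    rw [complex_d]; rfl
  hom_exact Q hQ n φ hφ := by
    obtain ⟨n, rfl⟩ : ∃ k, n = k + 1 := ⟨n - 1, by ring⟩
    obtain ⟨m, hm⟩ : ∃ m, m = n + 1 - 1 := ⟨_, rfl⟩
    rw [← hm]
    obtain rfl : m = n := by lia
    rw [complex_d] at hφ ⊢
    have : Module.Projective S Q := (IsProjective.iff_projective _).mpr hQ
    let φ' : D.P (m + 1) →ₗ[S] Q := φ.hom
    have hker : LinearMap.ker (D.p (m + 1)) ≤ LinearMap.ker φ' := by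
      intro x hx
      obtain ⟨y, rfl⟩ := (D.exact (m + 1) x).mp hx
      obtain ⟨z, rfl⟩ := D.surjective (m + 1 + 1) y
      exact LinearMap.congr_fun (congrArg ModuleCat.Hom.hom hφ) z
    obtain ⟨χ, hχ⟩ := (D.p (m + 1)).exists_comp_eq_of_ker_le (D.surjective _) φ' hker
    obtain ⟨ψ, hψ⟩ := D.extends_to_projective Q m χ
    refine ⟨ModuleCat.ofHom ψ, ModuleCat.hom_ext ?_⟩
    change φ' = ψ ∘ₗ D.i m ∘ₗ D.p (m + 1)
    rw [← hχ, ← hψ]; rfl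

lemma isGorensteinProjective {M : ModuleCat.{u} S} (e : D.N 0 ≃ₗ[S] M) :
    IsGorensteinProjective S M := by
  refine ⟨D.complex, D.isCompleteProjectiveResolution, ⟨?_⟩⟩
  let d : D.P (0 + 1) →ₗ[S] D.P 0 := D.i 0 ∘ₗ D.p (0 + 1)
  have hd : D.complex.d 1 0 = ModuleCat.ofHom d := D.complex_d 0
  have hrange : LinearMap.range d = LinearMap.ker (D.p 0) := by
    ext x
    refine Iff.trans ?_ (D.exact 0 x).symm
    constructor
    · rintro ⟨y, rfl⟩; exact ⟨D.p (0 + 1) y, rfl⟩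
    · rintro ⟨y, rfl⟩
      obtain ⟨z, rfl⟩ := D.surjective (0 + 1) y
      exact ⟨z, rfl⟩
  exact Limits.cokernelIsoOfEq hd ≪≫ ModuleCat.cokernelIsoRangeQuotient (ModuleCat.ofHom d) ≪≫
    LinearEquiv.toModuleIso ((Submodule.quotEquivOfEq _ _ hrange).trans
      (((D.p 0).quotKerEquivOfSurjective (D.surjective 0)).trans e))

end SplicedResolution

end

/-! ### Reflexivity, approximations and the dual of Schanuel's lemma -/

section Duality

variable {S : Type u} [CommRing S]
  {A B D : Type u} [AddCommGroup A] [Module S A] [AddCommGroup B] [Module S B]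
  [AddCommGroup D] [Module S D]

lemma exact_dualMap {f : A →ₗ[S] B} {g : B →ₗ[S] D} (hg : Function.Surjective g)
    (h : Function.Exact f g) : Function.Exact g.dualMap f.dualMap := by
  intro φ
  constructor
  · intro hφ
    obtain ⟨χ, hχ⟩ := g.exists_comp_eq_of_ker_le hg φ fun x hx => by
      obtain ⟨y, rfl⟩ := (h x).mp hx
      exact LinearMap.congr_fun hφ y
    exact ⟨χ, hχ⟩
  · rintro ⟨χ, rfl⟩
    ext x
    exact (congrArg χ (h.apply_apply_eq_zero x)).trans (map_zero χ)

/-- The kernel of a map from a reflexive module to a torsionless module is reflexive if linear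
forms extend. -/
lemma isReflexive_of_exact {f : A →ₗ[S] B} {g : B →ₗ[S] D} (hf : Function.Injective f)
    (h : Function.Exact f g) [Module.IsReflexive S B]
    (hext : Function.Surjective f.dualMap) (hD : Function.Injective (Module.Dual.eval S D)) :
    Module.IsReflexive S A where
  bijective_dual_eval' := by
    constructor
    · refine (injective_iff_map_eq_zero _).mpr fun a ha => ?_
      refine (injective_iff_map_eq_zero _).mp hf a ?_
      refine (injective_iff_map_eq_zero _).mp (Module.bijective_dual_eval S B).1 _ ?_
      ext ψ
      exact LinearMap.congr_fun ha (f.dualMap ψ)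
    · intro ξ
      obtain ⟨b, hb⟩ := (Module.bijective_dual_eval S B).2 (ξ ∘ₗ f.dualMap)
      have hgb : g b = 0 := by
        refine (injective_iff_map_eq_zero _).mp hD _ ?_
        ext θ
        refine (LinearMap.congr_fun hb (g.dualMap θ)).trans ?_
        have : f.dualMap (g.dualMap θ) = 0 := by
          ext x
          exact (congrArg θ (h.apply_apply_eq_zero x)).trans (map_zero θ)
        rw [LinearMap.comp_apply, this, map_zero]; rfl
      obtain ⟨a, rfl⟩ := (h b).mp hgb
      refine ⟨a, LinearMap.ext fun ψ => ?_⟩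
      obtain ⟨ψ, rfl⟩ := hext ψ
      exact LinearMap.congr_fun hb ψ

/-- Linear forms on a submodule of a finite module that extend do so with values in any projective
module. -/
lemma exists_extension_to_projective [Module.Finite S A] {f : A →ₗ[S] B}
    (hext : Function.Surjective f.dualMap) {Q : Type u} [AddCommGroup Q] [Module S Q]
    [Module.Projective S Q] (φ : A →ₗ[S] Q) : ∃ ψ : B →ₗ[S] Q, ψ ∘ₗ f = φ := by
  classical
  obtain ⟨s, hs⟩ := Module.projective_def'.mp ‹Module.Projective S Q›
  choose ext hE using hext
  obtain ⟨G, hG⟩ := (Module.Finite.fg_top : (⊤ : Submodule S A).FG)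
  -- Embed `Q` in a free module: only finitely many coordinates are nonzero on the generators of
  -- `A`, and each is a linear form that extends.
  let t : Finset Q := G.biUnion fun a => (s (φ a)).support
  let ψ : B →ₗ[S] (Q →₀ S) := ∑ q ∈ t, Finsupp.lsingle q ∘ₗ ext (Finsupp.lapply q ∘ₗ s ∘ₗ φ)
  have hψ : ψ ∘ₗ f = s ∘ₗ φ := by
    refine LinearMap.ext_on hG ?_
    intro a ha
    have h1 : ∀ q, ext (Finsupp.lapply q ∘ₗ s ∘ₗ φ) (f a) = s (φ a) q := fun q =>
      LinearMap.congr_fun (hE (Finsupp.lapply q ∘ₗ s ∘ₗ φ)) a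
    have hsub : (s (φ a)).support ⊆ t := fun q hq => Finset.mem_biUnion.mpr ⟨a, ha, hq⟩
    simp only [ψ, LinearMap.comp_apply, LinearMap.sum_apply, h1, Finsupp.lsingle_apply]
    conv_rhs => rw [← Finsupp.sum_single (s (φ a))]
    exact (Finsupp.sum_of_support_subset _ hsub _ (by simp)).symm
  refine ⟨Finsupp.linearCombination S id ∘ₗ ψ, ?_⟩
  rw [LinearMap.comp_assoc, hψ, ← LinearMap.comp_assoc, hs, LinearMap.id_comp]

/-- The dual of Schanuel's lemma. -/
lemma nonempty_equiv_of_approximations {L A' B' : Type u} [AddCommGroup L] [Module S L]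
    [AddCommGroup A'] [Module S A'] [AddCommGroup B'] [Module S B']
    {a : L →ₗ[S] A} {p : A →ₗ[S] A'} {b : L →ₗ[S] B} {q : B →ₗ[S] B'}
    (hp : Function.Surjective p) (hap : Function.Exact a p)
    (hq : Function.Surjective q) (hbq : Function.Exact b q)
    (α : A →ₗ[S] B) (hα : α ∘ₗ a = b) (β : B →ₗ[S] A) (hβ : β ∘ₗ b = a) :
    Nonempty ((A' × B) ≃ₗ[S] (B' × A)) := by
  let π₁ : A × B →ₗ[S] A' × B := (p ∘ₗ LinearMap.fst S A B).prod
    (LinearMap.snd S A B - α ∘ₗ LinearMap.fst S A B)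
  let π₂ : A × B →ₗ[S] B' × A := (q ∘ₗ LinearMap.snd S A B).prod
    (LinearMap.fst S A B - β ∘ₗ LinearMap.snd S A B)
  have h₁ : Function.Surjective π₁ := fun ⟨x, y⟩ => by
    obtain ⟨x, rfl⟩ := hp x
    exact ⟨(x, y + α x), by simp [π₁]⟩
  have h₂ : Function.Surjective π₂ := fun ⟨y, x⟩ => by
    obtain ⟨y, rfl⟩ := hq y
    exact ⟨(x + β y, y), by simp [π₂]⟩
  have hα' : ∀ l, α (a l) = b l := LinearMap.congr_fun hα
  have hβ' : ∀ l, β (b l) = a l := LinearMap.congr_fun hβ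
  have hker : LinearMap.ker π₁ = LinearMap.ker π₂ := by
    ext ⟨x, y⟩
    simp only [LinearMap.mem_ker, π₁, π₂, LinearMap.prod_apply, Function.prod, LinearMap.comp_apply,
      LinearMap.fst_apply, LinearMap.snd_apply, LinearMap.sub_apply, Prod.mk_eq_zero, sub_eq_zero]
    constructor
    · rintro ⟨hx, rfl⟩
      obtain ⟨l, rfl⟩ := (hap x).mp hx
      rw [hα', hβ']
      exact ⟨hbq.apply_apply_eq_zero l, rfl⟩
    · rintro ⟨hy, rfl⟩
      obtain ⟨l, rfl⟩ := (hbq y).mp hy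
      rw [hβ', hα']
      exact ⟨hap.apply_apply_eq_zero l, rfl⟩
  exact ⟨(π₁.quotKerEquivOfSurjective h₁).symm.trans ((Submodule.quotEquivOfEq _ _ hker).trans
    (π₂.quotKerEquivOfSurjective h₂))⟩

end Duality

/-! ### Finite replacements of cosyzygies -/

/-- Isomorphism of modules up to projective summands. -/
def IsStablyEquiv (S : Type u) [CommRing S] (M N : Type u) [AddCommGroup M] [Module S M]
    [AddCommGroup N] [Module S N] : Prop :=
  ∃ P Q : ModuleCat.{u} S, Module.Projective S P ∧ Module.Projective S Q ∧
    Nonempty ((M × P) ≃ₗ[S] (N × Q))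

namespace SplicedResolution

variable {S : Type u} [CommRing S] (D : SplicedResolution S)
  {M : Type u} [AddCommGroup M] [Module S M]

/-- `M` embeds in the projective module `P n × Q`, where linear forms separate points. -/
lemma eval_injective_of_isStablyEquiv {n : ℤ} (h : IsStablyEquiv S M (D.N (n + 1))) :
    Function.Injective (Module.Dual.eval S M) := by
  obtain ⟨P, Q, hP, hQ, ⟨e⟩⟩ := h
  have := D.projective n
  let j : M →ₗ[S] D.P n × Q :=
    (LinearMap.prodMap (D.i n) LinearMap.id) ∘ₗ e.toLinearMap ∘ₗ LinearMap.inl S M P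
  have hj : Function.Injective j :=
    (Function.Injective.prodMap (D.injective n) Function.injective_id).comp
      (e.injective.comp LinearMap.inl_injective)
  refine (injective_iff_map_eq_zero _).mpr fun x hx => (injective_iff_map_eq_zero _).mp hj x ?_
  refine (injective_iff_map_eq_zero _).mp (Module.eval_apply_injective S) (j x) ?_
  ext ψ
  exact LinearMap.congr_fun hx (ψ ∘ₗ j)

lemma exists_extension_prod {A B Q Z : Type u} [AddCommGroup A] [Module S A] [AddCommGroup B]
    [Module S B] [AddCommGroup Q] [Module S Q] [AddCommGroup Z] [Module S Z] (f : A →ₗ[S] B)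
    (h : ∀ φ : A →ₗ[S] Z, ∃ ψ : B →ₗ[S] Z, ψ ∘ₗ f = φ) (φ : A × Q →ₗ[S] Z) :
    ∃ ψ : B × Q →ₗ[S] Z, ψ ∘ₗ LinearMap.prodMap f LinearMap.id = φ := by
  obtain ⟨ψ, hψ⟩ := h (φ ∘ₗ LinearMap.inl S A Q)
  refine ⟨LinearMap.coprod ψ (φ ∘ₗ LinearMap.inr S A Q), LinearMap.prod_ext ?_ ?_⟩
  · ext x
    exact (congrArg₂ (· + ·) (LinearMap.congr_fun hψ x) (map_zero φ)).trans (add_zero _)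
  · ext; simp

lemma exact_prodMap_id {A B E : Type u} (Q : Type u) [AddCommGroup A] [Module S A]
    [AddCommGroup B] [Module S B] [AddCommGroup E] [Module S E] [AddCommGroup Q] [Module S Q]
    {f : A →ₗ[S] B} {g : B →ₗ[S] E} (h : Function.Exact f g) :
    Function.Exact (LinearMap.prodMap f (LinearMap.id : Q →ₗ[S] Q)) (g ∘ₗ LinearMap.fst S B Q) := by
  rintro ⟨x, y⟩
  refine (h x).trans ⟨?_, ?_⟩
  · rintro ⟨z, rfl⟩; exact ⟨(z, y), rfl⟩
  · rintro ⟨⟨z, w⟩, hz⟩; exact ⟨z, congrArg Prod.fst hz⟩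

/-- After adding projectives, `f` and `i n` become maps out of the same module, and each extends
along the other. The dual of Schanuel's lemma compares their cokernels, so a finite cokernel can
stand for `N n`, which may be infinite. -/
lemma isStablyEquiv_cokernel {n : ℤ} (h : IsStablyEquiv S M (D.N (n + 1))) [Module.Finite S M]
    {F : Type u} [AddCommGroup F] [Module S F] [Module.Projective S F] (f : M →ₗ[S] F)
    (hext : Function.Surjective f.dualMap) :
    IsStablyEquiv S (F ⧸ LinearMap.range f) (D.N n) := by
  obtain ⟨P, Q, hP, hQ, ⟨e⟩⟩ := h
  have := D.projective n
  have h1 := exact_prodMap_id P (LinearMap.exact_map_mkQ_range f)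
  have h2 : Function.Exact (LinearMap.prodMap (D.i n) (LinearMap.id : Q →ₗ[S] Q) ∘ₗ e.toLinearMap)
      (D.p n ∘ₗ LinearMap.fst S (D.P n) Q) := by
    intro x
    refine (exact_prodMap_id Q (D.exact n) x).trans ⟨?_, ?_⟩
    · rintro ⟨y, rfl⟩; exact ⟨e.symm y, by simp⟩
    · rintro ⟨y, rfl⟩; exact ⟨e y, rfl⟩
  obtain ⟨α, hα⟩ := exists_extension_prod (Q := P) (Z := D.P n × Q) f
    (fun φ => exists_extension_to_projective hext φ)
    (LinearMap.prodMap (D.i n) (LinearMap.id : Q →ₗ[S] Q) ∘ₗ e.toLinearMap)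
  obtain ⟨β, hβ⟩ := exists_extension_prod (Q := Q) (Z := F × P) (D.i n)
    (fun φ => D.extends_to_projective _ n φ)
    (LinearMap.prodMap f (LinearMap.id : P →ₗ[S] P) ∘ₗ e.symm.toLinearMap)
  have hs : Function.Surjective (D.p n ∘ₗ LinearMap.fst S (D.P n) Q) :=
    (D.surjective n).comp Prod.fst_surjective
  have hs' : Function.Surjective ((LinearMap.range f).mkQ ∘ₗ LinearMap.fst S F P) :=
    (Submodule.mkQ_surjective _).comp Prod.fst_surjective
  have hβ' : β ∘ₗ (LinearMap.prodMap (D.i n) (LinearMap.id : Q →ₗ[S] Q) ∘ₗ e.toLinearMap) =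
      LinearMap.prodMap f (LinearMap.id : P →ₗ[S] P) :=
    LinearMap.ext fun x => by simpa using LinearMap.congr_fun hβ (e x)
  obtain ⟨e'⟩ := nonempty_equiv_of_approximations hs' h1 hs h2 α hα β hβ'
  exact ⟨ModuleCat.of S (D.P n × Q), ModuleCat.of S (F × P), inferInstance, inferInstance, ⟨e'⟩⟩

/-- Finitely many generators of the dual serve as the coordinates of `f`. -/
lemma exists_dualMap_surjective [IsNoetherianRing S] [Module.Finite S M] :
    ∃ (k : ℕ) (f : M →ₗ[S] (Fin k → S)), Function.Surjective f.dualMap := by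
  obtain ⟨k, g, hg⟩ := Module.Finite.exists_fin' S (Module.Dual S M)
  refine ⟨k, LinearMap.pi fun j => g (Pi.single j 1), fun ψ => ?_⟩
  obtain ⟨c, rfl⟩ := hg ψ
  refine ⟨∑ j, c j • LinearMap.proj j, ?_⟩
  ext m
  have hc : c = ∑ j, c j • Pi.single j (1 : S) := by
    ext l; simp [Finset.sum_apply, Pi.single_apply]
  conv_rhs => rw [hc]
  simp

lemma dualMap_injective_imp {F : Type u} [AddCommGroup F] [Module S F] {f : M →ₗ[S] F}
    (hext : Function.Surjective f.dualMap) (hM : Function.Injective (Module.Dual.eval S M)) :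
    Function.Injective f := by
  refine (injective_iff_map_eq_zero _).mpr fun x hx => (injective_iff_map_eq_zero _).mp hM x ?_
  ext ψ
  obtain ⟨ψ, rfl⟩ := hext ψ
  exact (congrArg ψ hx).trans (map_zero ψ)

/-- Both `M` and the cokernel of its finite free approximation are torsionless, which is why the
index is lowered twice. -/
lemma isReflexive_of_isStablyEquiv [IsNoetherianRing S] [Module.Finite S M] {n : ℤ}
    (h : IsStablyEquiv S M (D.N n)) : Module.IsReflexive S M := by
  obtain ⟨n, rfl⟩ : ∃ k, n = k + 1 + 1 := ⟨n - 1 - 1, by ring⟩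
  obtain ⟨k, f, hf⟩ := exists_dualMap_surjective (S := S) (M := M)
  exact isReflexive_of_exact
    (dualMap_injective_imp hf (D.eval_injective_of_isStablyEquiv h))
    (LinearMap.exact_map_mkQ_range f) hf
    (D.eval_injective_of_isStablyEquiv (D.isStablyEquiv_cokernel h f hf))

end SplicedResolution

/-! ### Dualizing forms: `S`-duality as `C`-duality -/

/-- An `R`-linear map `S → C` such that `s ↦ ℓ (· * s)` is a bijection `S → Hom_R(S, C)`, where
`S` is moreover `Hom_R(-, C)`-acyclic. -/
structure IsDualizingForm {R S C : Type u} [CommRing R] [CommRing S] [Algebra R S]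
    [AddCommGroup C] [Module R C] (ℓ : S →ₗ[R] C) : Prop where
  existsUnique : ∀ φ : S →ₗ[R] C, ∃! s, ∀ t, ℓ (t * s) = φ t
  ext : ∀ i, Subsingleton (ExtMod R S C (i + 1))

namespace IsDualizingForm

variable {R S C : Type u} [CommRing R] [CommRing S] [Algebra R S]
  [AddCommGroup C] [Module R C] {ℓ : S →ₗ[R] C} (hℓ : IsDualizingForm ℓ)

include hℓ in
lemma eq_of_forall {s s' : S} (h : ∀ t, ℓ (t * s) = ℓ (t * s')) : s = s' := by
  obtain ⟨x, -, hx⟩ := hℓ.existsUnique (ℓ ∘ₗ LinearMap.mulRight R s')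
  rw [hx s h, hx s' fun t => rfl]

include hℓ in
lemma finite [IsNoetherianRing R] [Module.Finite R C] : Module.Finite R S := by
  refine finite_of_selfDual ((LinearMap.mul R S).compr₂ ℓ) ⟨fun s s' h => ?_, fun φ => ?_⟩ hℓ.ext
  · exact hℓ.eq_of_forall fun t => LinearMap.congr_fun h t
  · obtain ⟨s, hs, -⟩ := hℓ.existsUnique φ
    exact ⟨s, LinearMap.ext hs⟩

section

variable (M : Type u) [AddCommGroup M] [Module S M] [Module R M] [IsScalarTower R S M]

/-- `Hom_S(M, S) ≅ Hom_R(M, C)`. -/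
noncomputable def homEquiv : Module.Dual S M ≃ₗ[R] (M →ₗ[R] C) :=
  LinearEquiv.ofBijective
    { toFun := fun φ => ℓ ∘ₗ φ.restrictScalars R
      map_add' := fun φ ψ => by ext; simp
      map_smul' := fun r φ => by ext; simp } <| by
    constructor
    · refine fun φ ψ h => LinearMap.ext fun m => hℓ.eq_of_forall fun t => ?_
      have := LinearMap.congr_fun h (t • m)
      simpa using this
    · intro θ
      -- The `S`-linear lift sends `m` to the element representing `t ↦ θ (t • m)`; uniqueness makes
      -- it linear.
      choose s hs using fun m : M => (hℓ.existsUnique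
        (θ ∘ₗ ((LinearMap.toSpanSingleton S M m).restrictScalars R))).exists
      refine ⟨{ toFun := s, map_add' := fun m m' => ?_, map_smul' := fun a m => ?_ }, ?_⟩
      · refine hℓ.eq_of_forall fun t => ?_
        rw [hs, mul_add, map_add, hs, hs]
        simp
      · refine hℓ.eq_of_forall fun t => ?_
        rw [hs, RingHom.id_apply, smul_eq_mul, ← mul_assoc, hs]
        simp [mul_smul]
      · ext m
        have := hs m 1
        simpa using this

variable {M}

include hℓ in
-- A projective module is a retract of a free one, whose `Ext` is a product of copies of `Ext(S, C)
-- = 0`.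
lemma ext_projective [Module.Projective S M] (i : ℕ) : Subsingleton (ExtMod R M C (i + 1)) := by
  obtain ⟨s, hs⟩ := Module.projective_def'.mp ‹Module.Projective S M›
  refine ExtMod.subsingleton_of_retract (s.restrictScalars R)
    ((Finsupp.linearCombination S (id : M → M)).restrictScalars R)
    (LinearMap.ext fun x => LinearMap.congr_fun hs x) ?_
  have := hℓ.ext i
  exact (ExtMod.bijective_finsupp S M (i + 1) C).1.subsingleton

end

section

variable {A B D : Type u} [AddCommGroup A] [Module S A] [Module R A] [IsScalarTower R S A]
  [AddCommGroup B] [Module S B] [Module R B] [IsScalarTower R S B]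
  [AddCommGroup D] [Module S D] [Module R D] [IsScalarTower R S D]
  {f : A →ₗ[S] B} {g : B →ₗ[S] D}

include hℓ

lemma dualMap_surjective (hf : Function.Injective f) (hg : Function.Surjective g)
    (h : Function.Exact f g) (hD : Subsingleton (ExtMod R D C 1)) :
    Function.Surjective f.dualMap := by
  intro φ
  obtain ⟨ψ, hψ⟩ := ExtMod.exists_extension (f := f.restrictScalars R) (g := g.restrictScalars R)
    hf hg h hD (hℓ.homEquiv A φ)
  obtain ⟨χ, rfl⟩ := (hℓ.homEquiv B).surjective ψ
  exact ⟨χ, (hℓ.homEquiv A).injective hψ⟩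

lemma ext_one_of_dualMap_surjective (hf : Function.Injective f) (hg : Function.Surjective g)
    (h : Function.Exact f g) (hB : Subsingleton (ExtMod R B C 1))
    (hext : Function.Surjective f.dualMap) : Subsingleton (ExtMod R D C 1) := by
  refine ExtMod.subsingleton_one (f := f.restrictScalars R) (g := g.restrictScalars R)
    hf hg h hB fun φ => ?_
  obtain ⟨φ, rfl⟩ := (hℓ.homEquiv A).surjective φ
  obtain ⟨ψ, rfl⟩ := hext φ
  exact ⟨hℓ.homEquiv B ψ, rfl⟩

end

include hℓ in
-- In `0 → D* → B* → A* → 0`, a form on `D*` is evaluation at some `d`; evaluation at a lift of `d`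
-- to `B` extends it to `B*`.
lemma ext_dual_one {A B D : Type u} [AddCommGroup A] [Module S A] [AddCommGroup B] [Module S B]
    [AddCommGroup D] [Module S D] {f : A →ₗ[S] B} {g : B →ₗ[S] D}
    (hg : Function.Surjective g)
    (h : Function.Exact f g) [Module.Projective S (Module.Dual S B)]
    (hext : Function.Surjective f.dualMap) (hD : Function.Surjective (Module.Dual.eval S D)) :
    Subsingleton (ExtMod R (Module.Dual S A) C 1) := by
  refine hℓ.ext_one_of_dualMap_surjective (g.dualMap_injective_of_surjective hg) hext
    (exact_dualMap hg h) (hℓ.ext_projective 0) fun ξ => ?_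
  obtain ⟨d, rfl⟩ := hD ξ
  obtain ⟨b, rfl⟩ := hg d
  exact ⟨Module.Dual.eval S B b, rfl⟩

end IsDualizingForm

/-! ### Totally reflexive and Gorenstein projective modules -/

/-- Totally reflexive `S`-modules, with `Ext_S(-, S)` expressed as `Ext_R(-, C)`. -/
structure IsTotallyReflexive (R : Type u) {S : Type u} (C M : Type u) [CommRing R] [CommRing S]
    [Algebra R S] [AddCommGroup C] [Module R C] [AddCommGroup M] [Module S M] [Module R M]
    [IsScalarTower R S M] : Prop where
  finite : Module.Finite S M
  reflexive : Module.IsReflexive S M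
  ext : ∀ i, Subsingleton (ExtMod R M C (i + 1))
  ext_dual : ∀ i, Subsingleton (ExtMod R (Module.Dual S M) C (i + 1))

namespace IsTotallyReflexive

variable {R S C : Type u} [CommRing R] [CommRing S] [Algebra R S]
  [AddCommGroup C] [Module R C]
  {M : Type u} [AddCommGroup M] [Module S M] [Module R M] [IsScalarTower R S M]
  {N : Type u} [AddCommGroup N] [Module S N] [Module R N] [IsScalarTower R S N]

lemma congr (h : IsTotallyReflexive R (S := S) C M) (e : M ≃ₗ[S] N) :
    IsTotallyReflexive R (S := S) C N where
  finite := have := h.finite; Module.Finite.equiv e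
  reflexive := have := h.reflexive; Module.equiv e
  ext i := ExtMod.subsingleton_congr (e.symm.restrictScalars R) (h.ext i)
  ext_dual i := ExtMod.subsingleton_congr (e.dualMap.restrictScalars R) (h.ext_dual i)

lemma dual [IsNoetherianRing S] (h : IsTotallyReflexive R (S := S) C M) :
    IsTotallyReflexive R (S := S) C (Module.Dual S M) where
  finite := have := h.finite; inferInstance
  reflexive := have := h.reflexive; inferInstance
  ext := h.ext_dual
  ext_dual i := have := h.reflexive
    ExtMod.subsingleton_congr ((Module.evalEquiv S M).symm.restrictScalars R) (h.ext i)

variable {ℓ : S →ₗ[R] C} (hℓ : IsDualizingForm ℓ)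

include hℓ in
lemma syzygy [IsNoetherianRing S] (h : IsTotallyReflexive R (S := S) C M) {F : Type u}
    [AddCommGroup F] [Module S F] [Module R F] [IsScalarTower R S F] [Module.Finite S F]
    [Module.Free S F] {f : N →ₗ[S] F} {g : F →ₗ[S] M} (hf : Function.Injective f)
    (hg : Function.Surjective g) (hfg : Function.Exact f g) :
    IsTotallyReflexive R (S := S) C N := by
  have hext := hℓ.dualMap_surjective hf hg hfg (h.ext 0)
  refine ⟨Module.Finite.of_injective f hf,
    isReflexive_of_exact hf hfg hext h.reflexive.bijective_dual_eval'.1, fun i => ?_, fun i => ?_⟩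
  · exact ExtMod.subsingleton_left (f := f.restrictScalars R) (g := g.restrictScalars R)
      hf hg hfg (hℓ.ext_projective i) (h.ext (i + 1))
  · rcases i with _ | i
    · exact hℓ.ext_dual_one hg hfg hext h.reflexive.bijective_dual_eval'.2
    · exact ExtMod.subsingleton_right (f := g.dualMap.restrictScalars R)
        (g := f.dualMap.restrictScalars R) (g.dualMap_injective_of_surjective hg) hext
        (exact_dualMap hg hfg) (h.ext_dual i) (hℓ.ext_projective (i + 1))

end IsTotallyReflexive

lemma IsStablyEquiv.of_equiv {S : Type u} [CommRing S] {M N : Type u} [AddCommGroup M] [Module S M]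
    [AddCommGroup N] [Module S N] (e : M ≃ₗ[S] N) : IsStablyEquiv S M N :=
  ⟨ModuleCat.of S PUnit, ModuleCat.of S PUnit, inferInstance, inferInstance,
    ⟨e.prodCongr (LinearEquiv.refl S _)⟩⟩

section

variable {R S C : Type u} [CommRing R] [CommRing S] [Algebra R S]
  [AddCommGroup C] [Module R C] {ℓ : S →ₗ[R] C} (hℓ : IsDualizingForm ℓ)

namespace SplicedResolution

variable (D : SplicedResolution S)

include hℓ

/-- Dimension shifting along finite cosyzygies; reflexivity of the cosyzygy settles the first
degree. -/
lemma subsingleton_ext_dual [IsNoetherianRing S] (i : ℕ) : ∀ {n : ℤ} {M : Type u}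
    [AddCommGroup M] [Module S M] [Module.Finite S M], IsStablyEquiv S M (D.N n) →
    Subsingleton (ExtMod R (Module.Dual S M) C (i + 1)) := by
  induction i with
  | zero =>
    intro n M _ _ _ h
    obtain ⟨n, rfl⟩ : ∃ k, n = k + 1 := ⟨n - 1, by ring⟩
    obtain ⟨k, f, hf⟩ := exists_dualMap_surjective (S := S) (M := M)
    have := D.isReflexive_of_isStablyEquiv (D.isStablyEquiv_cokernel h f hf)
    exact hℓ.ext_dual_one (Submodule.mkQ_surjective _) (LinearMap.exact_map_mkQ_range f) hf
      (Module.bijective_dual_eval S _).2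
  | succ i ih =>
    intro n M _ _ _ h
    obtain ⟨n, rfl⟩ : ∃ k, n = k + 1 := ⟨n - 1, by ring⟩
    obtain ⟨k, f, hf⟩ := exists_dualMap_surjective (S := S) (M := M)
    have hmk := Submodule.mkQ_surjective (LinearMap.range f)
    exact ExtMod.subsingleton_right
      (f := (LinearMap.range f).mkQ.dualMap.restrictScalars R) (g := f.dualMap.restrictScalars R)
      (LinearMap.dualMap_injective_of_surjective hmk) hf
      (exact_dualMap hmk (LinearMap.exact_map_mkQ_range f))
      (ih (D.isStablyEquiv_cokernel h f hf)) (hℓ.ext_projective (i + 1))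

/-- Extension of forms from `N (n + 1)` to `P n` gives vanishing in degree one for every `n`; higher
degrees shift to `N (n + 1)`. -/
lemma subsingleton_ext [∀ n, Module R (D.N n)] [∀ n, IsScalarTower R S (D.N n)] (i : ℕ) :
    ∀ n, Subsingleton (ExtMod R (D.N n) C (i + 1)) := by
  let _ : ∀ n, Module R (D.P n) := fun n => Module.compHom _ (algebraMap R S)
  have _ : ∀ n, IsScalarTower R S (D.P n) := fun n => IsScalarTower.of_algebraMap_smul fun _ _ => rfl
  have hP : ∀ i n, Subsingleton (ExtMod R (D.P n) C (i + 1)) := fun i n =>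
    have := D.projective n
    hℓ.ext_projective i
  induction i with
  | zero =>
    exact fun n => hℓ.ext_one_of_dualMap_surjective (D.injective n) (D.surjective n) (D.exact n)
      (hP 0 n) fun φ => D.extends_to_projective S n φ
  | succ i ih =>
    exact fun n => ExtMod.subsingleton_right (f := (D.i n).restrictScalars R)
      (g := (D.p n).restrictScalars R) (D.injective n) (D.surjective n) (D.exact n)
      (ih (n + 1)) (hP (i + 1) n)

/-- Finitely generated Gorenstein projective modules are totally reflexive. -/
lemma isTotallyReflexive [IsNoetherianRing S] {M : Type u} [AddCommGroup M] [Module S M]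
    [Module R M] [IsScalarTower R S M] [Module.Finite S M] (e : D.N 0 ≃ₗ[S] M) :
    IsTotallyReflexive R (S := S) C M where
  finite := inferInstance
  reflexive := D.isReflexive_of_isStablyEquiv (IsStablyEquiv.of_equiv e.symm)
  ext i := by
    let _ : ∀ n, Module R (D.N n) := fun n => Module.compHom _ (algebraMap R S)
    have _ : ∀ n, IsScalarTower R S (D.N n) :=
      fun n => IsScalarTower.of_algebraMap_smul fun _ _ => rfl
    exact ExtMod.subsingleton_congr (e.symm.restrictScalars R) (D.subsingleton_ext hℓ i 0)
  ext_dual i := D.subsingleton_ext_dual hℓ i (IsStablyEquiv.of_equiv e.symm)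

end SplicedResolution

lemma exists_int_chain {α : Type*} {r : α → α → Prop} (hl : ∀ b, ∃ a, r a b)
    (hr : ∀ a, ∃ b, r a b) (a : α) : ∃ N : ℤ → α, N 0 = a ∧ ∀ n, r (N (n + 1)) (N n) := by
  choose up hup using hl
  choose down hdown using hr
  refine ⟨fun n => match n with
    | Int.ofNat n => up^[n] a
    | Int.negSucc n => down^[n + 1] a, rfl, fun n => ?_⟩
  match n with
  | Int.ofNat n =>
    change r (up^[n + 1] a) (up^[n] a)
    rw [Function.iterate_succ_apply']
    exact hup _
  | Int.negSucc 0 => exact hdown a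
  | Int.negSucc (n + 1) =>
    change r (down^[n + 1] a) (down^[n + 1 + 1] a)
    rw [Function.iterate_succ_apply' down (n + 1)]
    exact hdown _

variable (R S C) in
/-- The totally reflexive modules as a type. -/
structure TotallyReflexiveModule where
  carrier : Type u
  [addCommGroup : AddCommGroup carrier]
  [module : Module S carrier]
  [moduleBase : Module R carrier]
  [isScalarTower : IsScalarTower R S carrier]
  isTotallyReflexive : IsTotallyReflexive R (S := S) C carrier

namespace TotallyReflexiveModule

attribute [instance] addCommGroup module moduleBase isScalarTower

/-- `A` is a syzygy of `B`. -/
def IsSyzygy (A B : TotallyReflexiveModule R S C) : Prop :=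
  ∃ (P : ModuleCat.{u} S) (i : A.carrier →ₗ[S] P) (p : P →ₗ[S] B.carrier),
    Module.Projective S P ∧ Function.Injective i ∧ Function.Surjective p ∧ Function.Exact i p

variable [IsNoetherianRing S]

include hℓ

lemma exists_isSyzygy_left (B : TotallyReflexiveModule R S C) : ∃ A, IsSyzygy A B := by
  have := B.isTotallyReflexive.finite
  obtain ⟨k, g, hg⟩ := Module.Finite.exists_fin' S B.carrier
  exact ⟨⟨LinearMap.ker g, B.isTotallyReflexive.syzygy hℓ (Submodule.injective_subtype _) hg
    (LinearMap.exact_subtype_ker_map g)⟩, ModuleCat.of S (Fin k → S), (LinearMap.ker g).subtype, g,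
    inferInstance, Submodule.injective_subtype _, hg, LinearMap.exact_subtype_ker_map g⟩

/-- Dualize a finite free cover of `A*` and identify `A` with `A**`. -/
lemma exists_isSyzygy_right (A : TotallyReflexiveModule R S C) : ∃ B, IsSyzygy A B := by
  have := A.isTotallyReflexive.finite
  have := A.isTotallyReflexive.reflexive
  obtain ⟨k, g, hg⟩ := Module.Finite.exists_fin' S (Module.Dual S A.carrier)
  have hj := Submodule.injective_subtype (LinearMap.ker g)
  have hex := LinearMap.exact_subtype_ker_map g
  have hK := A.isTotallyReflexive.dual.syzygy hℓ hj hg hex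
  refine ⟨⟨Module.Dual S (LinearMap.ker g), hK.dual⟩, ModuleCat.of S (Module.Dual S (Fin k → S)),
    g.dualMap ∘ₗ (Module.evalEquiv S A.carrier).toLinearMap, (LinearMap.ker g).subtype.dualMap,
    inferInstanceAs (Module.Projective S (Module.Dual S (Fin k → S))),
    (LinearMap.dualMap_injective_of_surjective hg).comp (Module.evalEquiv S A.carrier).injective,
    hℓ.dualMap_surjective hj hg hex (A.isTotallyReflexive.ext_dual 0), fun x => ?_⟩
  refine (exact_dualMap hg hex x).trans ⟨?_, ?_⟩
  · rintro ⟨y, rfl⟩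
    exact ⟨(Module.evalEquiv S A.carrier).symm y,
      congrArg g.dualMap ((Module.evalEquiv S A.carrier).apply_symm_apply y)⟩
  · rintro ⟨y, rfl⟩
    exact ⟨_, rfl⟩

end TotallyReflexiveModule

include hℓ in
/-- Totally reflexive modules are Gorenstein projective. -/
lemma IsTotallyReflexive.isGorensteinProjective [IsNoetherianRing S] {M : ModuleCat.{u} S}
    [Module R M] [IsScalarTower R S M] (h : IsTotallyReflexive R (S := S) C M) :
    IsGorensteinProjective S M := by
  obtain ⟨N, h0, hN⟩ := exists_int_chain (TotallyReflexiveModule.exists_isSyzygy_left hℓ)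
    (TotallyReflexiveModule.exists_isSyzygy_right hℓ) ⟨M, h⟩
  choose P i p hP hi hp hip using hN
  let D : SplicedResolution S :=
    { N := fun n => ModuleCat.of S (N n).carrier
      P := P
      i := i
      p := p
      projective := hP
      injective := hi
      surjective := hp
      exact := hip
      extends_to_projective := fun Q _ _ _ n φ => by
        have := (N (n + 1)).isTotallyReflexive.finite
        let _ : Module R (P n) := Module.compHom _ (algebraMap R S)
        have _ : IsScalarTower R S (P n) := IsScalarTower.of_algebraMap_smul fun _ _ => rfl
        exact exists_extension_to_projective (hℓ.dualMap_surjective (hi n) (hp n) (hip n)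
          ((N n).isTotallyReflexive.ext 0)) φ }
  have e : Nonempty ((N 0).carrier ≃ₗ[S] M) := by
    rw [h0]; exact ⟨LinearEquiv.refl S M⟩
  exact D.isGorensteinProjective e.some

end

/-! ### The homothety map -/

section Homothety

variable {R C : Type u} [CommRing R] [AddCommGroup C] [Module R C]

/-- Write `u = e 1`, so every endomorphism is a multiple of `u`. From `id = r u` and `u² = s u` it
follows that `u = s · id`, so every endomorphism is a homothety. -/
lemma bijective_lsmul_of_equiv (e : R ≃ₗ[R] (C →ₗ[R] C)) :
    Function.Bijective (LinearMap.lsmul R C) := by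
  have he : ∀ φ : C →ₗ[R] C, φ = e.symm φ • e 1 := fun φ => by
    rw [← map_smul, smul_eq_mul, mul_one, LinearEquiv.apply_symm_apply]
  set r := e.symm LinearMap.id
  set s := e.symm (e 1 ∘ₗ e 1)
  have h1 : ∀ c, r • e 1 c = c := fun c => (LinearMap.congr_fun (he LinearMap.id) c).symm
  have h2 : ∀ c, e 1 (e 1 c) = s • e 1 c := LinearMap.congr_fun (he (e 1 ∘ₗ e 1))
  have h3 : ∀ c, e 1 c = s • c := fun c => by
    have := h2 (r • c)
    rwa [map_smul, h1] at this
  constructor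
  · refine (injective_iff_map_eq_zero _).mpr fun x hx => ?_
    have : e x = 0 := by
      rw [← mul_one x, ← smul_eq_mul, map_smul]
      exact LinearMap.ext fun c => LinearMap.congr_fun hx (e 1 c)
    exact (map_eq_zero_iff e e.injective).mp this
  · intro φ
    refine ⟨e.symm φ * s, LinearMap.ext fun c => ?_⟩
    conv_rhs => rw [he φ]
    rw [LinearMap.smul_apply, h3, smul_smul]
    rfl

lemma annihilator_eq_bot_of_injective (h : Function.Injective (LinearMap.lsmul R C)) :
    Module.annihilator R C = ⊥ :=
  (Submodule.eq_bot_iff _).mpr fun r hr => (injective_iff_map_eq_zero _).mp h r <|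
    LinearMap.ext fun c => Module.mem_annihilator.mp hr c

lemma lsmul_injective_of_annihilator_eq_bot (h : Module.annihilator R C = ⊥) :
    Function.Injective (LinearMap.lsmul R C) :=
  (injective_iff_map_eq_zero _).mpr fun r hr => (Submodule.eq_bot_iff _).mp h r <|
    Module.mem_annihilator.mpr fun c => LinearMap.congr_fun hr c

/-- A homothety map into an endomorphism ring, all of whose `C`-valued forms are evaluations, is an
isomorphism as soon as it is injective. -/
lemma lsmul_surjective_of_forall_eq_eval [IsNoetherianRing R] [Module.Finite R C]
    (hC : Module.annihilator R C = ⊥)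
    (hext : ∀ i, Subsingleton (ExtMod R (C →ₗ[R] C) C (i + 1)))
    (heval : ∀ h : (C →ₗ[R] C) →ₗ[R] C, ∃ c, ∀ φ, h φ = φ c) :
    Function.Surjective (LinearMap.lsmul R C) := by
  set χ := LinearMap.lsmul R C
  have hχ : Function.Injective χ := lsmul_injective_of_annihilator_eq_bot hC
  have hmk := Submodule.mkQ_surjective (LinearMap.range χ)
  have hex := LinearMap.exact_map_mkQ_range χ
  -- Degree zero: a form on the cokernel is evaluation at some `c`, and vanishing at the identity
  -- gives `c = 0`. Degree one: a map `R → C` extends as an evaluation. Higher degrees come from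
  -- `hext`.
  have hvan : ∀ i, Subsingleton (ExtMod R ((C →ₗ[R] C) ⧸ LinearMap.range χ) C i) := by
    intro i
    match i with
    | 0 =>
      have : Subsingleton (((C →ₗ[R] C) ⧸ LinearMap.range χ) →ₗ[R] C) := by
        refine subsingleton_of_forall_eq 0 fun θ => LinearMap.ext fun x => ?_
        obtain ⟨φ, rfl⟩ := hmk x
        obtain ⟨c, hc⟩ := heval (θ ∘ₗ (LinearMap.range χ).mkQ)
        have h1 : (LinearMap.range χ).mkQ (χ 1) = 0 := hex.apply_apply_eq_zero 1
        have h0 : c = 0 := by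
          have := hc (χ 1)
          rw [LinearMap.comp_apply, h1, map_zero] at this
          rw [this]
          exact (one_smul R c).symm
        have := hc φ
        rwa [h0, map_zero] at this
      exact (ExtMod.zeroEquiv R _ C).injective.subsingleton
    | 1 =>
      refine ExtMod.subsingleton_one hχ hmk hex (hext 0) fun φ =>
        ⟨LinearMap.applyₗ (φ 1), LinearMap.ext_ring ?_⟩
      exact one_smul R (φ 1)
    | i + 2 =>
      exact ExtMod.subsingleton_right hχ hmk hex (ExtMod.subsingleton_of_projective R C i)
        (hext (i + 1))
  have h := ExtMod.annihilator_smul_top_of_forall_subsingleton hvan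
  obtain ⟨r, hr, hrC⟩ := Submodule.exists_sub_one_mem_and_smul_eq_zero_of_fg_of_le_smul _
    (⊤ : Submodule R C) Module.Finite.fg_top h.ge
  -- Faithfulness of `C` turns the Nakayama element `r` into zero, so `1` annihilates the cokernel.
  have hr0 : r = 0 := (Submodule.eq_bot_iff _).mp hC r
    (Module.mem_annihilator.mpr fun c => hrC c trivial)
  rw [hr0, zero_sub, neg_mem_iff] at hr
  intro φ
  have := Module.mem_annihilator.mp hr ((LinearMap.range χ).mkQ φ)
  rw [one_smul] at this
  exact (hex φ).mp this

end Homothety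

/-! ### Semidualizing modules and total reflexivity along the retract -/

section Retract

variable {R S C : Type u} [CommRing R] [CommRing S] [Algebra R S]
  [AddCommGroup C] [Module R C]

/-- Linearity along a retraction `g` is automatic. -/
def LinearEquiv.extendScalarsOfRetract {M N : Type*} [AddCommGroup M] [AddCommGroup N] [Module R M]
    [Module R N] [Module S M] [Module S N] (g : S →+* R) (hM : ∀ (s : S) (m : M), s • m = g s • m)
    (hN : ∀ (s : S) (n : N), s • n = g s • n) (e : M ≃ₗ[R] N) : M ≃ₗ[S] N :=
  { e with
    map_smul' := fun s m => by
      change e (s • m) = s • e m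
      rw [hM, hN, map_smul] }

namespace IsDualizingForm

variable {ℓ : S →ₗ[R] C} (hℓ : IsDualizingForm ℓ)

section

variable [Module S R] [IsScalarTower R S R]

/-- `Hom_S(R, S) ≅ C`. -/
noncomputable def dualBaseEquiv : Module.Dual S R ≃ₗ[R] C :=
  (hℓ.homEquiv R).trans (LinearMap.ringLmapEquivSelf R R C)

include hℓ in
-- Through `Hom_S(R, S) ≅ C`, the bidual of `R` becomes `Hom_R(C, C)` and evaluation at `r` becomes
-- multiplication by `r`.
lemma bijective_eval_iff : Function.Bijective (Module.Dual.eval S R) ↔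
    Function.Bijective (LinearMap.lsmul R C) := by
  let e := (hℓ.homEquiv (Module.Dual S R)).trans
    (LinearEquiv.congrLeft C R hℓ.dualBaseEquiv)
  have he : ∀ r, e (Module.Dual.eval S R r) = LinearMap.lsmul R C r := fun r => by
    refine LinearMap.ext fun c => ?_
    obtain ⟨φ, rfl⟩ := hℓ.dualBaseEquiv.surjective c
    have h1 : e (Module.Dual.eval S R r) (hℓ.dualBaseEquiv φ) =
        ℓ (hℓ.dualBaseEquiv.symm (hℓ.dualBaseEquiv φ) r) := rfl
    have h2 : φ r = r • φ 1 := by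
      rw [← LinearMap.map_smul_of_tower, smul_eq_mul, mul_one]
    rw [h1, LinearEquiv.symm_apply_apply, h2, map_smul]
    rfl
  rw [← e.bijective.of_comp_iff']
  exact iff_of_eq (congrArg _ (funext he))

include hℓ in
lemma isTotallyReflexive_base [Module.Finite R S] (hb : Function.Bijective (LinearMap.lsmul R C))
    (hC : ∀ i, Subsingleton (ExtMod R C C (i + 1))) : IsTotallyReflexive R (S := S) C R where
  finite := Module.Finite.of_restrictScalars_finite R S R
  reflexive := ⟨hℓ.bijective_eval_iff.mpr hb⟩
  ext i := ExtMod.subsingleton_of_projective R C i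
  ext_dual i := ExtMod.subsingleton_congr hℓ.dualBaseEquiv (hC i)

include hℓ in
lemma isSemidualizing_of_base [Module.Finite R C] (h : IsTotallyReflexive R (S := S) C R) :
    IsSemidualizing R C where
  finite := inferInstance
  hom_iso := ⟨LinearEquiv.ofBijective (LinearMap.lsmul R C)
    (hℓ.bijective_eval_iff.mp h.reflexive.bijective_dual_eval')⟩
  ext_vanishing i hi := by
    obtain ⟨i, rfl⟩ := Nat.exists_eq_add_of_le' hi
    exact ExtMod.subsingleton_congr hℓ.dualBaseEquiv.symm (h.ext_dual i)

end

include hℓ in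
-- The `S`-dual of `C` is `Hom_R(C, C)`: reflexivity says that its `C`-valued forms are evaluations,
-- and total reflexivity that its higher `Ext` into `C` vanishes.
lemma isSemidualizing_of_annihilator_eq_bot [IsNoetherianRing R] [Module.Finite R C] [Module S C]
    [IsScalarTower R S C] (h : IsTotallyReflexive R (S := S) C C)
    (hC : Module.annihilator R C = ⊥) : IsSemidualizing R C where
  finite := inferInstance
  hom_iso := by
    refine ⟨LinearEquiv.ofBijective (LinearMap.lsmul R C)
      ⟨lsmul_injective_of_annihilator_eq_bot hC, lsmul_surjective_of_forall_eq_eval hC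
        (fun i => ExtMod.subsingleton_congr (hℓ.homEquiv C).symm (h.ext_dual i)) fun θ => ?_⟩⟩
    obtain ⟨ξ, hξ⟩ := (hℓ.homEquiv (Module.Dual S C)).surjective
      (θ ∘ₗ (hℓ.homEquiv C).toLinearMap)
    obtain ⟨c, rfl⟩ := h.reflexive.bijective_dual_eval'.2 ξ
    refine ⟨c, fun φ => ?_⟩
    obtain ⟨φ, rfl⟩ := (hℓ.homEquiv C).surjective φ
    exact (LinearMap.congr_fun hξ φ).symm
  ext_vanishing i hi := by
    obtain ⟨i, rfl⟩ := Nat.exists_eq_add_of_le' hi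
    exact h.ext i

end IsDualizingForm

end Retract

/-- In the second and third conditions, the `R`-modules `R` and `C` are `S`-modules through `g : S → R`. -/
theorem theorem3p6 {R S : Type u} [CommRing R] [IsNoetherianRing R] [CommRing S]
    (f : R →+* S) (g : S →+* R)
    (C : Type u) [AddCommGroup C] [Module R C] [Module.Finite R C]
    (h : IsDualizingRetract f g C) :
    List.TFAE [
      IsSemidualizing R C,
      IsGorensteinProjective S ((ModuleCat.restrictScalars g).obj (ModuleCat.of R R)) ∧
        Module.annihilator R C = ⊥,
      IsGorensteinProjective S ((ModuleCat.restrictScalars g).obj (ModuleCat.of R C)) ∧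
        Module.annihilator R C = ⊥] := by
  have hgf : ∀ r, g (f r) = r := RingHom.congr_fun h.retract
  let _ : Algebra R S := f.toAlgebra
  let _ : Module S R := Module.compHom R g
  let _ : Module S C := Module.compHom C g
  have _ : IsScalarTower R S R := IsScalarTower.of_algebraMap_smul fun r x =>
    congrArg (· • x) (hgf r)
  have _ : IsScalarTower R S C := IsScalarTower.of_algebraMap_smul fun r x =>
    congrArg (· • x) (hgf r)
  obtain ⟨e⟩ := h.hom_iso
  -- By `S`-linearity `e.symm s = s • ℓ`, so the image of `1` determines the whole isomorphism.
  let ℓ : S →ₗ[R] C := e.symm 1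
  have hℓ : IsDualizingForm ℓ := by
    refine ⟨fun φ => ?_, fun i => h.ext_vanishing (i + 1) (Nat.le_add_left 1 i)⟩
    let E : (S →ₗ[R] C) ≃ S := e.toEquiv
    have key : ∀ s t, ℓ (t * s) = E.symm s t := fun s t => by
      have h1 : e.symm s = s • e.symm 1 := by rw [← map_smul, smul_eq_mul, mul_one]
      exact (LinearMap.congr_fun (congrArg (ModuleCat.CoextendScalars.equiv f _) h1) t).symm
    refine ⟨E φ, fun t => (key _ t).trans (by rw [Equiv.symm_apply_apply]), fun s hs => ?_⟩
    rw [← E.symm_apply_eq]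
    exact LinearMap.ext fun t => (key s t).symm.trans (hs t)
  have := hℓ.finite
  have : IsNoetherianRing S := IsNoetherianRing.of_finite R S
  have : Module.Finite S R := Module.Finite.of_restrictScalars_finite R S R
  have : Module.Finite S C := Module.Finite.of_restrictScalars_finite R S C
  have hbase : IsSemidualizing R C → IsTotallyReflexive R (S := S) C R := fun hC =>
    hℓ.isTotallyReflexive_base (bijective_lsmul_of_equiv hC.hom_iso.some)
      fun i => hC.ext_vanishing (i + 1) (Nat.le_add_left 1 i)
  have hann : IsSemidualizing R C → Module.annihilator R C = ⊥ := fun hC =>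
    annihilator_eq_bot_of_injective (bijective_lsmul_of_equiv hC.hom_iso.some).1
  tfae_have 1 → 2 := fun hC =>
    ⟨IsTotallyReflexive.isGorensteinProjective hℓ (M := ModuleCat.of S R) (hbase hC), hann hC⟩
  tfae_have 1 → 3 := fun hC => by
    -- `C` is the `S`-dual of the totally reflexive module `R`. The remaining check is that `S` acts
    -- on this dual through `g`.
    refine ⟨IsTotallyReflexive.isGorensteinProjective hℓ (M := ModuleCat.of S C)
      ((hbase hC).dual.congr (hℓ.dualBaseEquiv.extendScalarsOfRetract g (fun s φ => ?_)
        fun _ _ => rfl)), hann hC⟩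
    refine LinearMap.ext fun x => ?_
    have h1 : s • φ x = φ (s • x) := (map_smul φ s x).symm
    have h2 : g s • φ x = φ (g s • x) := (LinearMap.map_smul_of_tower φ (g s) x).symm
    exact h1.trans h2.symm
  tfae_have 2 → 1 := fun ⟨hG, _⟩ => by
    obtain ⟨D, ⟨e⟩⟩ := hG.exists_spliced
    exact hℓ.isSemidualizing_of_base (D.isTotallyReflexive hℓ (M := R) e)
  tfae_have 3 → 1 := fun ⟨hG, hC⟩ => by
    obtain ⟨D, ⟨e⟩⟩ := hG.exists_spliced
    exact hℓ.isSemidualizing_of_annihilator_eq_bot (D.isTotallyReflexive hℓ (M := C) e) hC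
  tfae_finish
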